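/- Let $T>0$, $L\in\mathbb{N}$. A function on $[0,T]$ is *regulated* if it has one-sided limits at every point; $G[0,T]$ is the space of regulated real functions on $[0,T]$, $G_R[0,T]$ the subspace of right-continuous ones, and $BV_R[0,T]$ the set of functions of bounded variation in $G_R[0,T]$. For $r>0$ and $q\in G_R[0,T]$ let $\xi_r=\mathfrak p_r[q]\in BV_R[0,T]$ (the play operator) be the unique solution of $$|q(t)-\xi_r(t)|\le r\ \ \forall t\in[0,T],\qquad \int_0^T\big(q(t)-\xi_r(t)-z(t)\big)\,d\xi_r(t)\ge 0\ \ \forall z\in G[0,T],\ \sup_{[0,T]}|z|\le r,$$ $$\xi_r(0)=\max\{q(0)-r,\min\{0,q(0)+r\}\},$$ where the integral is the Kurzweil–Stieltjes integral. Let $\psi:\mathbb{R}^L\times(0,\infty)\times\mathbb{R}\to\mathbb{R}$ be (Lebesgue) measurable and, for a.e. $(r,v)\in(0,\infty)\times\mathbb{R}$, differentiable in its first variable on all of $\mathbb{R}^L$. Assume that for every $x\in\mathbb{R}^L$: (i) $0\le\psi(x,r,v)\le\mu(r)$ for a.e. $(r,v)$, where $\mu\in L^1(0,\infty)$, and put $M=\int_0^\infty\mu(r)\,dr$;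 (ii) $\|\nabla_x\psi(x,r,v)\|\le K(r,v)$ for a.e. $(r,v)$, where $\|\cdot\|$ is the Euclidean norm and $K\in L^1((0,\infty)\times\mathbb{R})$, and put $M_1=\int_0^\infty\int_{-\infty}^\infty K(r,v)\,dv\,dr$. For $u:[0,T]\to\mathbb{R}^L$ and $q\in G_R[0,T]$ define the Preisach operator $$P(u)[q](t)=\int_0^\infty\int_0^{\mathfrak p_r[q](t)}\psi(u(t),r,v)\,dv\,dr,\qquad t\in[0,T].$$ **Proposition.** Let $u:[0,T]\to\mathbb{R}^L$ and $w:[0,T]\to\mathbb{R}$ be continuous. Then the equation $$q(t)+P(u)[q](t)=w(t),\qquad t\in[0,T],$$ has a unique solution $q\in G_R[0,T]$, and $q$ is continuous on $[0,T]$. If, in addition, $u$ and $w$ are absolutely continuous on $[0,T]$, then $q$ is absolutely continuous on $[0,T]$, and for a.e. $t\in[0,T]$ the functions $q$, $w$, $u$ are differentiable at $t$ and $$|\dot q(t)|\le e^{M}\big(|\dot w(t)|+M_1\|\dot u(t)\|\big).$$ -/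

import Mathlib

open Set Filter Topology MeasureTheory

noncomputable section

namespace Preisach

/-- Regulated functions on `[0,T]`: both one-sided limits exist (in the space) at every point, with
no condition from the left at `0` and from the right at `T`. Functions on `[0,T]` are represented
by functions on `ℝ` whose values outside `[0,T]` are irrelevant. -/
def IsRegulated (T : ℝ) (f : ℝ → ℝ) : Prop :=
  (∀ t ∈ Ico 0 T, ∃ l, Tendsto f (𝓝[>] t) (𝓝 l)) ∧
  (∀ t ∈ Ioc 0 T, ∃ l, Tendsto f (𝓝[<] t) (𝓝 l))

/-- The space `G_R[0,T]` of right-continuous regulated functions on `[0,T]`. -/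
def IsRightContRegulated (T : ℝ) (f : ℝ → ℝ) : Prop :=
  IsRegulated T f ∧ ∀ t ∈ Ico 0 T, ContinuousWithinAt f (Ici t) t

/-- `a = s 0 < s 1 < ⋯ < s n = b` is a division of `[a,b]` with tags `τ i ∈ [s i, s (i+1)]`. -/
def IsTaggedDivision (a b : ℝ) (n : ℕ) (s τ : ℕ → ℝ) : Prop :=
  s 0 = a ∧ s n = b ∧ ∀ i < n, s i < s (i + 1) ∧ τ i ∈ Icc (s i) (s (i + 1))

/-- The tagged division `(s, τ)` is fine with respect to the gauge `δ`. -/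
def IsFine (δ : ℝ → ℝ) (n : ℕ) (s τ : ℕ → ℝ) : Prop :=
  ∀ i < n, Icc (s i) (s (i + 1)) ⊆ Ioo (τ i - δ (τ i)) (τ i + δ (τ i))

/-- The Kurzweil-Stieltjes integral `∫_a^b f dg` exists and equals `I`. -/
def HasKSIntegral (f g : ℝ → ℝ) (a b I : ℝ) : Prop :=
  ∀ ε > 0, ∃ δ : ℝ → ℝ, (∀ x, 0 < δ x) ∧
    ∀ (n : ℕ) (s τ : ℕ → ℝ), IsTaggedDivision a b n s τ → IsFine δ n s τ →
      |∑ i ∈ Finset.range n, f (τ i) * (g (s (i + 1)) - g (s i)) - I| < ε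

/-- `ξ` is a solution in `BV_R[0,T]`, with input `q` and threshold `r`, of the
Kurzweil-Stieltjes integral variational inequality that defines the play operator. -/
structure IsPlay (T r : ℝ) (q ξ : ℝ → ℝ) : Prop where
  boundedVariation : BoundedVariationOn ξ (Icc 0 T)
  rightContinuous : IsRightContRegulated T ξ
  abs_sub_le : ∀ t ∈ Icc 0 T, |q t - ξ t| ≤ r
  variational : ∀ z : ℝ → ℝ, IsRegulated T z → (∀ t ∈ Icc 0 T, |z t| ≤ r) →
    ∃ I, HasKSIntegral (fun t => q t - ξ t - z t) ξ 0 T I ∧ 0 ≤ I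
  initial : ξ 0 = max (q 0 - r) (min 0 (q 0 + r))

/-- The play operator `𝔭_r[q]`: the solution of the variational inequality. For right-continuous
regulated `q` and `r > 0` the solution exists and is unique on `[0,T]`. -/
def play (T r : ℝ) (q : ℝ → ℝ) : ℝ → ℝ :=
  Classical.epsilon (IsPlay T r q)

/-- The parameter-dependent Preisach operator
`P(u)[q](t) = ∫_0^∞ ∫_0^{𝔭_r[q](t)} ψ(u(t), r, v) dv dr`. -/
def preisach {L : ℕ} (ψ : EuclideanSpace ℝ (Fin L) → ℝ → ℝ → ℝ) (T : ℝ)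
    (u : ℝ → EuclideanSpace ℝ (Fin L)) (q : ℝ → ℝ) (t : ℝ) : ℝ :=
  ∫ r in Ioi (0 : ℝ), ∫ v in (0 : ℝ)..play T r q t, ψ (u t) r v

/-- The standing hypothesis on the density `ψ`, with the bounds `μ ∈ L¹(0,∞)` and
`K ∈ L¹((0,∞) × ℝ)`. Measurability of `ψ` is Lebesgue measurability on `ℝ^L × (0,∞) × ℝ`. That
`∇_u ψ` is meaningful is the field `differentiable`. -/
structure DensityHyp {L : ℕ} (ψ : EuclideanSpace ℝ (Fin L) → ℝ → ℝ → ℝ)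
    (μ : ℝ → ℝ) (K : ℝ → ℝ → ℝ) : Prop where
  measurable : AEMeasurable
    (fun p : EuclideanSpace ℝ (Fin L) × ℝ × ℝ => ψ p.1 p.2.1 p.2.2)
    (volume.restrict (univ ×ˢ Ioi (0 : ℝ) ×ˢ univ))
  integrable_mu : IntegrableOn μ (Ioi 0)
  bounds : ∀ x, ∀ᵐ p : ℝ × ℝ ∂volume.restrict (Ioi (0 : ℝ) ×ˢ univ),
    0 ≤ ψ x p.1 p.2 ∧ ψ x p.1 p.2 ≤ μ p.1
  integrable_K : IntegrableOn (fun p : ℝ × ℝ => K p.1 p.2) (Ioi (0 : ℝ) ×ˢ univ)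
  differentiable : ∀ᵐ p : ℝ × ℝ ∂volume.restrict (Ioi (0 : ℝ) ×ˢ univ),
    Differentiable ℝ (fun x => ψ x p.1 p.2)
  gradient_bound : ∀ x, ∀ᵐ p : ℝ × ℝ ∂volume.restrict (Ioi (0 : ℝ) ×ˢ univ),
    ‖gradient (fun y => ψ y p.1 p.2) x‖ ≤ K p.1 p.2

/-- `q ∈ G_R[0,T]` solves `q(t) + P(u)[q](t) = w(t)` for all `t ∈ [0,T]`. -/
def IsSolution {L : ℕ} (ψ : EuclideanSpace ℝ (Fin L) → ℝ → ℝ → ℝ) (T : ℝ)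
    (u : ℝ → EuclideanSpace ℝ (Fin L)) (w q : ℝ → ℝ) : Prop :=
  IsRightContRegulated T q ∧ ∀ t ∈ Icc 0 T, q t + preisach ψ T u q t = w t

end Preisach

end

noncomputable section

namespace Preisach

/-! Everything rests on one stability estimate, `DensityHyp.abs_sub_le_of_residual`: if 0 ≤ λ ≤ 1
and the residuals q + λP(u)[q] of two inputs q₁, q₂ differ by at most ε on [0,T], then |q₁ - q₂| ≤
e^M ε there. Let d_r be the difference of the two plays with threshold r, and suppose |d_r| ≤ D(r)
on [0,T]. A positive d_r can grow only while q₁ pushes its play up or q₂ pushes its play down. At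
such an instant the 1-Lipschitz dependence of the play on the threshold forces d_s ≥ d_r for all s ≤
r. Since ψ ≥ 0, thresholds below r contribute nonnegatively to the difference of the Preisach terms,
and those above r contribute at least -∫_r^∞ μD. As d_r ≤ d_0 = q₁ - q₂ at that instant, d_r ≤ ε +
∫_r^∞ μD. This is a Gronwall inequality in the threshold, started at infinity; it gives |d_r| ≤ ε
exp(∫_r^∞ μ), and r → 0 recovers q.

Uniqueness is the case ε = 0. Existence follows by continuation in λ from 0 to 1 in C[0,T], the
estimate being uniform in λ (`exists_add_eq_of_lipschitz`). Regularity follows by comparing a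
solution with itself frozen at time s: up to s the residuals agree, and afterwards they differ by
the increments of w and, through K, of u (`DensityHyp.abs_increment_le`). Continuity, absolute
continuity and the derivative bound are read off from this increment estimate.

The play is defined only through a variational inequality, so it is first identified with an
explicit supremum formula (`play_eqOn_playFormula`). The link is the local description
`IsLocalPlay`: ξ can rise only where q - ξ = r and fall only where q - ξ = -r. Testing the
inequality with functions altered on a point or an interval gives this description; a comparison
principle shows that it determines ξ; and the formula satisfies it, has bounded variation, and
solves the inequality by step approximation of the integrand. -/

/-! ### Real induction and regulated functions -/

/-- Real induction on a compact interval. -/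
theorem real_induction {a b : ℝ} {P : ℝ → Prop} (h0 : P a)
    (hr : ∀ t ∈ Ico a b, (∀ x ∈ Icc a t, P x) → ∀ᶠ x in 𝓝[>] t, P x)
    (hl : ∀ t ∈ Ioc a b, (∀ x ∈ Ico a t, P x) → P t) :
    ∀ t ∈ Icc a b, P t := by
  intro b' hb'
  by_contra hPb
  set S : Set ℝ := {t | t ∈ Icc a b ∧ ¬ P t} with hS
  have hne : S.Nonempty := ⟨b', hb', hPb⟩
  have hbdd : BddBelow S := ⟨a, fun x hx => hx.1.1⟩
  set c := sInf S with hc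
  have hac : a ≤ c := le_csInf hne fun x hx => hx.1.1
  have hcb : c ≤ b := (csInf_le hbdd ⟨hb', hPb⟩).trans hb'.2
  have hlt : ∀ x ∈ Ico a c, P x := by
    intro x hx
    by_contra h
    exact absurd (csInf_le hbdd ⟨⟨hx.1, hx.2.le.trans hcb⟩, h⟩) (not_le.2 hx.2)
  have hPc : P c := by
    rcases hac.eq_or_lt with h | h
    · rw [← h]; exact h0
    · exact hl c ⟨h, hcb⟩ hlt
  have hle : ∀ x ∈ Icc a c, P x := by
    intro x hx
    rcases hx.2.eq_or_lt with h | h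
    · rw [h]; exact hPc
    · exact hlt x ⟨hx.1, h⟩
  have hcb' : c < b := by
    refine lt_of_le_of_ne (hcb) fun h => ?_
    exact hPb (hle b' ⟨hb'.1, h ▸ hb'.2⟩)
  have hev := hr c ⟨hac, hcb'⟩ hle
  obtain ⟨d, hd, hd'⟩ := (mem_nhdsGT_iff_exists_Ioo_subset).1 hev
  obtain ⟨x, hxS, hxd⟩ := exists_lt_of_csInf_lt hne (show sInf S < d from hd)
  rcases (csInf_le hbdd hxS).eq_or_lt with h | h
  · exact hxS.2 (h ▸ hPc)
  · exact hxS.2 (hd' ⟨h, hxd⟩)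

/-- A barrier principle for functions with one-sided limits. -/
theorem barrier {a b c : ℝ} {f : ℝ → ℝ} (h0 : f a ≤ c)
    (hrc : ∀ t ∈ Ico a b, ContinuousWithinAt f (Ici t) t)
    (hr : ∀ t ∈ Ico a b, c < f t → ∀ᶠ x in 𝓝[>] t, f x ≤ f t)
    (hl : ∀ t ∈ Ioc a b, c < f t → ∃ l, Tendsto f (𝓝[<] t) (𝓝 l) ∧ f t ≤ l) :
    ∀ t ∈ Icc a b, f t ≤ c := by
  intro t ht
  -- The slack c' > c serves where f equals c': there f exceeds c, so the one-sided hypotheses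
  -- apply. Where f < c', right continuity suffices.
  refine le_of_forall_gt_imp_ge_of_dense fun c' hc' => ?_
  refine real_induction (P := fun x => f x ≤ c') (h0.trans hc'.le) ?_ ?_ t ht
  · intro s hs hle
    have h1 := hle s ⟨hs.1, le_rfl⟩
    rcases h1.lt_or_eq with h | h
    · have := (hrc s hs).eventually (gt_mem_nhds h)
      exact (this.filter_mono (nhdsWithin_mono s Ioi_subset_Ici_self)).mono fun x hx => hx.le
    · exact (hr s hs (h ▸ hc')).mono fun x hx => hx.trans h1
  · intro s hs hlt
    by_contra hcon
    rw [not_le] at hcon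
    obtain ⟨l, hl1, hl2⟩ := hl s hs (hc'.trans hcon)
    have h2 : l ≤ c' := by
      refine le_of_tendsto hl1 ?_
      filter_upwards [Ioo_mem_nhdsLT hs.1] with x hx
      exact hlt x ⟨hx.1.le, hx.2⟩
    linarith

theorem IsRegulated.exists_right {T : ℝ} {f : ℝ → ℝ} (hf : IsRegulated T f) {t : ℝ}
    (ht : t ∈ Ico 0 T) {ε : ℝ} (hε : 0 < ε) :
    ∀ᶠ s in 𝓝[>] t, ∀ x ∈ Ioo t s, ∀ y ∈ Ioo t s, |f x - f y| ≤ ε := by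
  obtain ⟨l, hl⟩ := hf.1 t ht
  have := hl.eventually (Metric.ball_mem_nhds l (half_pos hε))
  obtain ⟨d, hd, hd'⟩ := (mem_nhdsGT_iff_exists_Ioo_subset).1 this
  filter_upwards [Ioo_mem_nhdsGT hd] with s hs x hx y hy
  have h1 : dist (f x) l < ε / 2 := hd' ⟨hx.1, hx.2.trans hs.2⟩
  have h2 : dist (f y) l < ε / 2 := hd' ⟨hy.1, hy.2.trans hs.2⟩
  rw [Real.dist_eq, abs_lt] at h1 h2
  rw [abs_le]; constructor <;> linarith

theorem IsRegulated.exists_left {T : ℝ} {f : ℝ → ℝ} (hf : IsRegulated T f) {t : ℝ}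
    (ht : t ∈ Ioc 0 T) {ε : ℝ} (hε : 0 < ε) :
    ∀ᶠ s in 𝓝[<] t, ∀ x ∈ Ioo s t, ∀ y ∈ Ioo s t, |f x - f y| ≤ ε := by
  obtain ⟨l, hl⟩ := hf.2 t ht
  have := hl.eventually (Metric.ball_mem_nhds l (half_pos hε))
  obtain ⟨d, hd, hd'⟩ := (mem_nhdsLT_iff_exists_Ioo_subset).1 this
  filter_upwards [Ioo_mem_nhdsLT hd] with s hs x hx y hy
  have h1 : dist (f x) l < ε / 2 := hd' ⟨hs.1.trans hx.1, hx.2⟩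
  have h2 : dist (f y) l < ε / 2 := hd' ⟨hs.1.trans hy.1, hy.2⟩
  rw [Real.dist_eq, abs_lt] at h1 h2
  rw [abs_le]; constructor <;> linarith

/-- Induction along a division on whose open intervals a regulated function oscillates little. -/
theorem IsRegulated.induction {T : ℝ} (hT : 0 ≤ T) {f : ℝ → ℝ} (hf : IsRegulated T f) {ε : ℝ}
    (hε : 0 < ε) {P : ℝ → Prop} (h0 : P 0)
    (step : ∀ s t, 0 ≤ s → s < t → t ≤ T →
      (∀ x ∈ Ioo s t, ∀ y ∈ Ioo s t, |f x - f y| ≤ ε) → P s → P t) : P T := by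
  refine real_induction (a := 0) (b := T) h0 ?_ ?_ T ⟨hT, le_rfl⟩
  · intro t ht hP
    filter_upwards [hf.exists_right ht hε, Ioo_mem_nhdsGT ht.2] with s hs hs'
    exact step t s ht.1 hs'.1 hs'.2.le hs (hP t ⟨ht.1, le_rfl⟩)
  · intro t ht hP
    obtain ⟨s, hs, hs'⟩ := ((hf.exists_left ht hε).and (Ioo_mem_nhdsLT ht.1)).exists
    exact step s t hs'.1.le hs'.2 ht.2 hs (hP s ⟨hs'.1.le, hs'.2⟩)

theorem IsRegulated.exists_bound {T : ℝ} (hT : 0 ≤ T) {f : ℝ → ℝ} (hf : IsRegulated T f) :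
    ∃ C, ∀ t ∈ Icc 0 T, |f t| ≤ C := by
  refine hf.induction hT one_pos (P := fun t => ∃ C, ∀ x ∈ Icc 0 t, |f x| ≤ C) ?_ ?_
  · refine ⟨|f 0|, fun x hx => ?_⟩
    rw [le_antisymm hx.2 hx.1]
  · rintro s t hs hst - hosc ⟨C, hC⟩
    refine ⟨max C (max (|f t|) (|f ((s + t) / 2)| + 1)), fun x hx => ?_⟩
    rcases le_or_gt x s with h | h
    · exact (hC x ⟨hx.1, h⟩).trans (le_max_left _ _)
    · rcases hx.2.eq_or_lt with h' | h'
      · rw [h']; exact (le_max_left _ _).trans (le_max_right _ _)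
      · refine le_trans ?_ ((le_max_right _ _).trans (le_max_right _ _))
        have := hosc x ⟨h, h'⟩ ((s + t) / 2) ⟨by linarith, by linarith⟩
        have h2 := abs_sub_abs_le_abs_sub (f x) (f ((s + t) / 2))
        linarith

theorem IsRegulated.sub {T : ℝ} {f g : ℝ → ℝ} (hf : IsRegulated T f) (hg : IsRegulated T g) :
    IsRegulated T (fun t => f t - g t) := by
  refine ⟨fun t ht => ?_, fun t ht => ?_⟩
  · obtain ⟨l, hl⟩ := hf.1 t ht
    obtain ⟨m, hm⟩ := hg.1 t ht
    exact ⟨_, hl.sub hm⟩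
  · obtain ⟨l, hl⟩ := hf.2 t ht
    obtain ⟨m, hm⟩ := hg.2 t ht
    exact ⟨_, hl.sub hm⟩

theorem IsRegulated.mono {S T : ℝ} (hST : S ≤ T) {f : ℝ → ℝ} (hf : IsRegulated T f) :
    IsRegulated S f :=
  ⟨fun t ht => hf.1 t ⟨ht.1, ht.2.trans_le hST⟩, fun t ht => hf.2 t ⟨ht.1, ht.2.trans hST⟩⟩

theorem IsRightContRegulated.mono {S T : ℝ} (hST : S ≤ T) {f : ℝ → ℝ}
    (hf : IsRightContRegulated T f) : IsRightContRegulated S f :=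
  ⟨hf.1.mono hST, fun t ht => hf.2 t ⟨ht.1, ht.2.trans_le hST⟩⟩

/-! ### The Kurzweil–Stieltjes integral of step functions -/

/-- Cousin's lemma. -/
theorem exists_fine_division {a b : ℝ} (hab : a ≤ b) {δ : ℝ → ℝ} (hδ : ∀ x, 0 < δ x) :
    ∃ (n : ℕ) (s τ : ℕ → ℝ), IsTaggedDivision a b n s τ ∧ IsFine δ n s τ := by
  have append : ∀ x y t, x < y → t ∈ Icc x y → Icc x y ⊆ Ioo (t - δ t) (t + δ t) →
      (∃ (n : ℕ) (s τ : ℕ → ℝ), IsTaggedDivision a x n s τ ∧ IsFine δ n s τ) →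
      ∃ (n : ℕ) (s τ : ℕ → ℝ), IsTaggedDivision a y n s τ ∧ IsFine δ n s τ := by
    rintro x y t hxy ht hsub ⟨n, s, τ, ⟨h1, h2, h3⟩, h4⟩
    refine ⟨n + 1, fun i => if i ≤ n then s i else y, fun i => if i < n then τ i else t,
      ⟨by simp [h1], by simp, fun i hi => ?_⟩, fun i hi => ?_⟩
    · rcases (Nat.lt_succ_iff.1 hi).lt_or_eq with h | h
      · simpa [h.le, h, Nat.succ_le_of_lt h] using h3 i h
      · subst h
        simpa [h2] using ⟨hxy, ht⟩
    · rcases (Nat.lt_succ_iff.1 hi).lt_or_eq with h | h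
      · simpa [h.le, h, Nat.succ_le_of_lt h] using h4 i h
      · subst h
        simpa [h2] using hsub
  refine real_induction
    (P := fun x => ∃ (n : ℕ) (s τ : ℕ → ℝ), IsTaggedDivision a x n s τ ∧ IsFine δ n s τ)
    ?_ ?_ ?_ b ⟨hab, le_rfl⟩
  · exact ⟨0, fun _ => a, fun _ => a, ⟨rfl, rfl, by simp⟩, fun i hi => by simp at hi⟩
  · intro t ht hP
    filter_upwards [Ioo_mem_nhdsGT (show t < t + δ t by linarith [hδ t])] with y hy
    refine append t y t hy.1 ⟨le_rfl, hy.1.le⟩ (fun z hz => ⟨?_, ?_⟩) (hP t ⟨ht.1, le_rfl⟩)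
    · linarith [hz.1, hδ t]
    · exact hz.2.trans_lt hy.2
  · intro t ht hP
    obtain ⟨x, hx⟩ := exists_between (show max a (t - δ t) < t from
      max_lt ht.1 (by linarith [hδ t]))
    have hx1 := max_lt_iff.1 hx.1
    refine append x t t hx.2 ⟨hx.2.le, le_rfl⟩ (fun z hz => ⟨?_, ?_⟩) (hP x ⟨hx1.1.le, hx.2⟩)
    · exact hx1.2.trans_le hz.1
    · linarith [hz.2, hδ t]

theorem IsTaggedDivision.monotone {a b : ℝ} {n : ℕ} {s τ : ℕ → ℝ}
    (h : IsTaggedDivision a b n s τ) {i j : ℕ} (hij : i ≤ j) (hj : j ≤ n) : s i ≤ s j := by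
  induction j, hij using Nat.le_induction with
  | base => exact le_rfl
  | succ k hk ih => exact (ih (by omega)).trans (h.2.2 k (by omega)).1.le

theorem IsTaggedDivision.mem_Icc {a b : ℝ} {n : ℕ} {s τ : ℕ → ℝ}
    (h : IsTaggedDivision a b n s τ) {i : ℕ} (hi : i ≤ n) : s i ∈ Icc a b :=
  ⟨h.1 ▸ h.monotone (Nat.zero_le i) hi, h.2.1 ▸ h.monotone hi le_rfl⟩

theorem IsTaggedDivision.tag_mem_Icc {a b : ℝ} {n : ℕ} {s τ : ℕ → ℝ}
    (h : IsTaggedDivision a b n s τ) {i : ℕ} (hi : i < n) : τ i ∈ Icc a b :=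
  ⟨(h.mem_Icc hi.le).1.trans (h.2.2 i hi).2.1, (h.2.2 i hi).2.2.trans (h.mem_Icc hi).2⟩

/-- Division sums are controlled by a local comparison with increments of `G`, up to increments
of `J`. -/
theorem IsTaggedDivision.abs_sum_sub_le {a b : ℝ} {n : ℕ} {s τ : ℕ → ℝ}
    (h : IsTaggedDivision a b n s τ) {F : ℕ → ℝ} {G J : ℝ → ℝ}
    (hF : ∀ i < n, |F i - (G (s (i + 1)) - G (s i))| ≤ J (s (i + 1)) - J (s i)) :
    |∑ i ∈ Finset.range n, F i - (G b - G a)| ≤ J b - J a := by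
  have h1 : G b - G a = ∑ i ∈ Finset.range n, (G (s (i + 1)) - G (s i)) := by
    rw [Finset.sum_range_sub (fun i => G (s i)), h.1, h.2.1]
  have h2 : J b - J a = ∑ i ∈ Finset.range n, (J (s (i + 1)) - J (s i)) := by
    rw [Finset.sum_range_sub (fun i => J (s i)), h.1, h.2.1]
  rw [h1, h2, ← Finset.sum_sub_distrib]
  refine (Finset.abs_sum_le_sum_abs _ _).trans (Finset.sum_le_sum fun i hi => ?_)
  exact hF i (Finset.mem_range.1 hi)

namespace HasKSIntegral

variable {a b I I' c : ℝ} {f f' g : ℝ → ℝ}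

theorem congr (h : HasKSIntegral f g a b I) (hf : EqOn f f' (Icc a b)) :
    HasKSIntegral f' g a b I := by
  intro ε hε
  obtain ⟨δ, hδ, H⟩ := h ε hε
  refine ⟨δ, hδ, fun n s τ h1 h2 => ?_⟩
  convert! H n s τ h1 h2 using 3
  refine Finset.sum_congr rfl fun i hi => ?_
  rw [hf (h1.tag_mem_Icc (Finset.mem_range.1 hi))]

theorem add (h : HasKSIntegral f g a b I) (h' : HasKSIntegral f' g a b I') :
    HasKSIntegral (fun x => f x + f' x) g a b (I + I') := by
  intro ε hε
  obtain ⟨δ, hδ, H⟩ := h (ε / 2) (half_pos hε)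
  obtain ⟨δ', hδ', H'⟩ := h' (ε / 2) (half_pos hε)
  refine ⟨fun x => min (δ x) (δ' x), fun x => lt_min (hδ x) (hδ' x), fun n s τ h1 h2 => ?_⟩
  have e1 := H n s τ h1 fun i hi => (h2 i hi).trans (Ioo_subset_Ioo
    (by linarith [min_le_left (δ (τ i)) (δ' (τ i))])
    (by linarith [min_le_left (δ (τ i)) (δ' (τ i))]))
  have e2 := H' n s τ h1 fun i hi => (h2 i hi).trans (Ioo_subset_Ioo
    (by linarith [min_le_right (δ (τ i)) (δ' (τ i))])
    (by linarith [min_le_right (δ (τ i)) (δ' (τ i))]))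
  simp only [add_mul, Finset.sum_add_distrib]
  rw [abs_lt] at *
  constructor <;> linarith [e1.1, e1.2, e2.1, e2.2]

theorem const_mul (h : HasKSIntegral f g a b I) (k : ℝ) :
    HasKSIntegral (fun x => k * f x) g a b (k * I) := by
  intro ε hε
  obtain ⟨δ, hδ, H⟩ := h (ε / (|k| + 1)) (by positivity)
  refine ⟨δ, hδ, fun n s τ h1 h2 => ?_⟩
  have := H n s τ h1 h2
  simp only [mul_assoc, ← Finset.mul_sum, ← mul_sub, abs_mul]
  rw [lt_div_iff₀ (by positivity)] at this
  nlinarith [abs_nonneg k, abs_nonneg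
    (∑ i ∈ Finset.range n, f (τ i) * (g (s (i + 1)) - g (s i)) - I)]

theorem sub (h : HasKSIntegral f g a b I) (h' : HasKSIntegral f' g a b I') :
    HasKSIntegral (fun x => f x - f' x) g a b (I - I') := by
  convert! h.add (h'.const_mul (-1)) using 1
  · ext x; ring
  · ring

theorem unique (hab : a ≤ b) (h : HasKSIntegral f g a b I) (h' : HasKSIntegral f g a b I') :
    I = I' := by
  have h0 := h.sub h'
  by_contra hne
  obtain ⟨δ, hδ, H⟩ := h0 |I - I'| (abs_pos.2 (sub_ne_zero.2 hne))
  obtain ⟨n, s, τ, h1, h2⟩ := exists_fine_division hab hδ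
  have := H n s τ h1 h2
  simp only [sub_self, zero_mul, Finset.sum_const_zero, zero_sub, abs_neg, lt_irrefl] at this

theorem abs_le_of_forall_sum_le (hab : a ≤ b) (h : HasKSIntegral f g a b I)
    {C : ℝ} (hC : ∀ n s τ, IsTaggedDivision a b n s τ →
      |∑ i ∈ Finset.range n, f (τ i) * (g (s (i + 1)) - g (s i))| ≤ C) : |I| ≤ C := by
  refine le_of_forall_pos_le_add fun ε hε => ?_
  obtain ⟨δ, hδ, H⟩ := h ε hε
  obtain ⟨n, s, τ, h1, h2⟩ := exists_fine_division hab hδ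
  have e1 := H n s τ h1 h2
  have e2 := hC n s τ h1
  rw [abs_lt] at e1
  rw [abs_le] at *
  constructor <;> linarith [e1.1, e1.2, e2.1, e2.2]

/-- A local criterion for integrability. -/
theorem of_local {G : ℝ → ℝ} (H : ∀ ε > 0, ∃ δ : ℝ → ℝ, (∀ x, 0 < δ x) ∧ ∃ J : ℝ → ℝ,
      J b - J a ≤ ε ∧ ∀ x ∈ Icc a b, ∀ y ∈ Icc a b, ∀ t ∈ Icc x y, x < y →
        Icc x y ⊆ Ioo (t - δ t) (t + δ t) →
        |f t * (g y - g x) - (G y - G x)| ≤ J y - J x) :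
    HasKSIntegral f g a b (G b - G a) := by
  intro ε hε
  obtain ⟨δ, hδ, J, hJ, H⟩ := H (ε / 2) (half_pos hε)
  refine ⟨δ, hδ, fun n s τ h1 h2 => ?_⟩
  have := h1.abs_sum_sub_le (F := fun i => f (τ i) * (g (s (i + 1)) - g (s i))) (G := G) (J := J)
    fun i hi => H _ (h1.mem_Icc hi.le) _ (h1.mem_Icc hi) _ (h1.2.2 i hi).2 (h1.2.2 i hi).1
      (h2 i hi)
  linarith

/-- The indefinite integral is g stopped at c. Only a division interval tagged at c can overshoot c,
and right continuity of g makes that error small. -/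
theorem indicator_Iic (hc : c ∈ Icc a b) (hg : ∀ t ∈ Ico a b, ContinuousWithinAt g (Ici t) t) :
    HasKSIntegral ((Iic c).indicator 1) g a b (g c - g a) := by
  have key : HasKSIntegral ((Iic c).indicator 1) g a b (g (min b c) - g (min a c)) := by
    refine of_local (G := fun x => g (min x c)) fun ε hε => ?_
    obtain ⟨η, hη, hη'⟩ : ∃ η > 0, ∀ y ∈ Icc c b, y < c + η → |g y - g c| ≤ ε := by
      rcases hc.2.eq_or_lt with h | h
      · refine ⟨1, one_pos, fun y hy _ => ?_⟩
        rw [le_antisymm (h ▸ hy.2) hy.1, sub_self, abs_zero]; exact hε.le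
      · have h1 := (hg c ⟨hc.1, h⟩).eventually (Metric.ball_mem_nhds (g c) hε)
        obtain ⟨d, hd, hd'⟩ := (mem_nhdsGE_iff_exists_Ico_subset).1 h1
        refine ⟨d - c, sub_pos.2 hd, fun y hy hyd => ?_⟩
        have : dist (g y) (g c) < ε := hd' ⟨hy.1, by linarith⟩
        rw [Real.dist_eq] at this
        exact this.le
    -- The gauge |x - c| keeps c out of every interval tagged elsewhere. The total error ε is
    -- charged to the jump of J at c, which is crossed at most once.
    refine ⟨fun x => if x = c then η else |x - c|, fun x => ?_,
      fun x => ε * (Ioi c).indicator 1 x, ?_, ?_⟩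
    · dsimp only
      split_ifs with h
      · exact hη
      · exact abs_pos.2 (sub_ne_zero.2 h)
    · have : a ∉ Ioi c := not_lt.2 hc.1
      beta_reduce
      rw [indicator_of_notMem this, mul_zero, sub_zero]
      by_cases h : b ∈ Ioi c <;> simp [h, hε.le]
    · intro x hx y hy t ht hxy hsub
      beta_reduce at hsub ⊢
      have hx' := hsub ⟨le_rfl, hxy.le⟩
      have hy' := hsub ⟨hxy.le, le_rfl⟩
      rcases lt_trichotomy t c with h | h | h
      · rw [if_neg h.ne, abs_of_neg (sub_neg.2 h)] at hx' hy'
        have hyc : y < c := by linarith [hy'.2]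
        have hxc : x < c := hxy.trans hyc
        simp [h.le, hyc.le, hxc.le]
      · rw [if_pos h] at hx' hy'
        subst h
        have e1 : min x t = x := min_eq_left ht.1
        have e2 : min y t = t := min_eq_right ht.2
        have e3 : x ∉ Ioi t := not_lt.2 ht.1
        rw [e1, e2, indicator_of_mem (self_mem_Iic (a := t)), indicator_of_notMem e3,
          show (1 : ℝ → ℝ) t * (g y - g x) - (g t - g x) = g y - g t by
            simp only [Pi.one_apply]; ring]
        rcases ht.2.eq_or_lt with h | h
        · subst h; simp
        · rw [indicator_of_mem (show y ∈ Ioi t from h)]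
          simpa using hη' y ⟨h.le, hy.2⟩ hy'.2
      · rw [if_neg h.ne', abs_of_pos (sub_pos.2 h)] at hx' hy'
        have hxc : c < x := by linarith [hx'.1]
        have hyc : c < y := hxc.trans hxy
        simp [h, hyc.le, hxc.le, hxc, hyc]
  rwa [min_eq_right hc.2, min_eq_left hc.1] at key

theorem indicator_Iio {l : ℝ} (hc : c ∈ Ioc a b) (hl : Tendsto g (𝓝[<] c) (𝓝 l)) :
    HasKSIntegral ((Iio c).indicator 1) g a b (l - g a) := by
  have key : HasKSIntegral ((Iio c).indicator 1) g a b
      ((if b < c then g b else l) - (if a < c then g a else l)) := by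
    -- The tag c now carries the value 0, so the interval tagged at c loses the increment of g from
    -- its left endpoint to c, which is close to the one ending at the left limit l.
    refine of_local (G := fun x => if x < c then g x else l) fun ε hε => ?_
    obtain ⟨d, hd, hd'⟩ := (mem_nhdsLT_iff_exists_Ioo_subset).1
      (hl.eventually (Metric.ball_mem_nhds l hε))
    refine ⟨fun x => if x = c then c - d else |x - c|, fun x => ?_,
      fun x => ε * (Ici c).indicator 1 x, ?_, ?_⟩
    · dsimp only
      split_ifs with h
      · exact sub_pos.2 hd
      · exact abs_pos.2 (sub_ne_zero.2 h)
    · have h1 : a ∉ Ici c := not_le.2 hc.1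
      have h2 : b ∈ Ici c := hc.2
      beta_reduce
      rw [indicator_of_notMem h1, indicator_of_mem h2]
      simp
    · intro x hx y hy t ht hxy hsub
      beta_reduce at hsub ⊢
      have hx' := hsub ⟨le_rfl, hxy.le⟩
      have hy' := hsub ⟨hxy.le, le_rfl⟩
      rcases lt_trichotomy t c with h | h | h
      · rw [if_neg h.ne, abs_of_neg (sub_neg.2 h)] at hx' hy'
        have hyc : y < c := by linarith [hy'.2]
        have hxc : x < c := hxy.trans hyc
        simp [h, hyc, hxc, hyc.not_ge, hxc.not_ge]
      · rw [if_pos h] at hx' hy'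
        subst h
        have e0 : t ∉ Iio t := lt_irrefl t
        have e2 : ¬ y < t := not_lt.2 ht.2
        rw [indicator_of_notMem e0, if_neg e2, indicator_of_mem (show y ∈ Ici t from ht.2)]
        rcases ht.1.eq_or_lt with h | h
        · subst h; simp
        · rw [if_pos h, indicator_of_notMem (show x ∉ Ici t from not_le.2 h)]
          have : dist (g x) l < ε := hd' ⟨by linarith [hx'.1], h⟩
          rw [Real.dist_eq] at this
          simpa [abs_sub_comm] using this.le
      · rw [if_neg h.ne', abs_of_pos (sub_pos.2 h)] at hx' hy'
        have hxc : c < x := by linarith [hx'.1]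
        have hyc : c < y := hxc.trans hxy
        simp [h.not_gt, hyc.not_gt, hxc.not_gt, hxc.le, hyc.le]
  rwa [if_neg (not_lt.2 hc.2), if_pos hc.1] at key

/-- The integral of a function supported at one point. -/
theorem single {l : ℝ} (hc : c ∈ Ioc a b) (hg : ∀ t ∈ Ico a b, ContinuousWithinAt g (Ici t) t)
    (hl : Tendsto g (𝓝[<] c) (𝓝 l)) :
    HasKSIntegral (({c} : Set ℝ).indicator 1) g a b (g c - l) := by
  convert! (indicator_Iic (g := g) (Ioc_subset_Icc_self hc) hg).sub (indicator_Iio hc hl) using 1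
  · ext x
    rcases lt_trichotomy x c with h | h | h
    · simp [h, h.le, h.ne]
    · simp [h]
    · simp [h.not_gt, h.not_ge, h.ne']
  · ring

theorem indicator_Ioc {c d : ℝ} (hc : a ≤ c) (hcd : c ≤ d) (hd : d ≤ b)
    (hg : ∀ t ∈ Ico a b, ContinuousWithinAt g (Ici t) t) :
    HasKSIntegral ((Ioc c d).indicator 1) g a b (g d - g c) := by
  convert! (indicator_Iic (g := g) ⟨hc.trans hcd, hd⟩ hg).sub
    (indicator_Iic (g := g) ⟨hc, hcd.trans hd⟩ hg) using 1
  · ext x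
    by_cases h1 : x ≤ c
    · simp [h1, h1.trans hcd, h1.not_gt]
    · by_cases h2 : x ≤ d <;> simp [h1, h2, not_le.1 h1]
  · ring

theorem indicator_Ioo {c d l : ℝ} (hc : a ≤ c) (hcd : c < d) (hd : d ≤ b)
    (hg : ∀ t ∈ Ico a b, ContinuousWithinAt g (Ici t) t) (hl : Tendsto g (𝓝[<] d) (𝓝 l)) :
    HasKSIntegral ((Ioo c d).indicator 1) g a b (l - g c) := by
  convert! (indicator_Iio (g := g) ⟨hc.trans_lt hcd, hd⟩ hl).sub
    (indicator_Iic (g := g) ⟨hc, hcd.le.trans hd⟩ hg) using 1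
  · ext x
    by_cases h1 : x ≤ c
    · simp [h1, h1.trans_lt hcd, h1.not_gt]
    · by_cases h2 : x < d <;> simp [h1, h2, not_le.1 h1]
  · ring

end HasKSIntegral

theorem IsTaggedDivision.abs_sum_le {a b : ℝ} {n : ℕ} {s τ : ℕ → ℝ}
    (h : IsTaggedDivision a b n s τ) {f g : ℝ → ℝ} (hg : BoundedVariationOn g (Icc a b)) {ε : ℝ}
    (hf : ∀ t ∈ Icc a b, |f t| ≤ ε) :
    |∑ i ∈ Finset.range n, f (τ i) * (g (s (i + 1)) - g (s i))| ≤
      ε * variationOnFromTo g (Icc a b) a b := by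
  have hab : a ≤ b := by have := (h.mem_Icc (Nat.zero_le n)); exact this.1.trans this.2
  set V := variationOnFromTo g (Icc a b) a
  have := h.abs_sum_sub_le (F := fun i => f (τ i) * (g (s (i + 1)) - g (s i))) (G := fun _ => 0)
    (J := fun x => ε * V x) ?_
  · simpa [V, variationOnFromTo.self] using this
  · intro i hi
    have h1 := variationOnFromTo.abs_sub_le_sub_of_le hg.locallyBoundedVariationOn
      (left_mem_Icc.2 hab) (h.mem_Icc hi.le) (h.mem_Icc hi) (h.2.2 i hi).1.le
    have h2 := hf _ (h.tag_mem_Icc hi)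
    simp only [sub_self, sub_zero, abs_mul, ← mul_sub]
    exact mul_le_mul h2 h1 (abs_nonneg _) ((abs_nonneg _).trans h2)

/-- Uniform limits of integrable functions are integrable against a function of bounded
variation. -/
theorem exists_hasKSIntegral_of_approx {a b : ℝ} (hab : a ≤ b) {f g : ℝ → ℝ}
    (hg : BoundedVariationOn g (Icc a b))
    (H : ∀ ε > 0, ∃ (h : ℝ → ℝ) (I : ℝ), HasKSIntegral h g a b I ∧ 0 ≤ I ∧
      ∀ t ∈ Icc a b, |h t - f t| ≤ ε) :
    ∃ I, HasKSIntegral f g a b I ∧ 0 ≤ I := by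
  set V := variationOnFromTo g (Icc a b) a b with hV
  have hV0 : 0 ≤ V := variationOnFromTo.nonneg_of_le _ _ hab
  choose h I h1 h2 h3 using fun n : ℕ => H (1 / ((n : ℝ) + 1)) (by positivity)
  have hlim : Tendsto (fun n : ℕ => 1 / ((n : ℝ) + 1)) atTop (𝓝 0) :=
    tendsto_one_div_add_atTop_nhds_zero_nat
  have hI : ∀ n m, |I n - I m| ≤ (1 / ((n : ℝ) + 1) + 1 / ((m : ℝ) + 1)) * V := by
    intro n m
    refine HasKSIntegral.abs_le_of_forall_sum_le hab ((h1 n).sub (h1 m)) fun k s τ hd => ?_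
    refine hd.abs_sum_le (f := fun x => h n x - h m x) hg fun t ht => ?_
    have e1 := abs_le.1 (h3 n t ht)
    have e2 := abs_le.1 (h3 m t ht)
    rw [abs_le]; constructor <;> linarith [e1.1, e1.2, e2.1, e2.2]
  have hC : CauchySeq I := by
    refine cauchySeq_of_le_tendsto_0 (fun N : ℕ => (1 / ((N : ℝ) + 1) + 1 / ((N : ℝ) + 1)) * V)
      (fun n m N hn hm => ?_) ?_
    · rw [Real.dist_eq]
      refine (hI n m).trans ?_
      gcongr
    · simpa using (hlim.add hlim).mul_const V
  obtain ⟨I0, hI0⟩ := cauchySeq_tendsto_of_complete hC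
  refine ⟨I0, fun ε hε => ?_, ge_of_tendsto' hI0 h2⟩
  obtain ⟨n, hn1, hn2⟩ : ∃ n, |I n - I0| < ε / 3 ∧ 1 / ((n : ℝ) + 1) * V < ε / 3 := by
    have e1 := hI0.eventually (Metric.ball_mem_nhds I0 (show 0 < ε / 3 by positivity))
    have e2 : ∀ᶠ n : ℕ in atTop, 1 / ((n : ℝ) + 1) * V < ε / 3 :=
      (hlim.mul_const V).eventually (gt_mem_nhds (by rw [zero_mul]; positivity))
    obtain ⟨n, hn1, hn2⟩ := (e1.and e2).exists
    exact ⟨n, by simpa [Real.dist_eq] using hn1, hn2⟩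
  obtain ⟨δ, hδ, H⟩ := h1 n (ε / 3) (by positivity)
  refine ⟨δ, hδ, fun k s τ hd hf => ?_⟩
  have e1 := H k s τ hd hf
  have e2 := hd.abs_sum_le (f := fun x => h n x - f x) hg (h3 n)
  simp only [sub_mul, Finset.sum_sub_distrib] at e2
  rw [abs_lt] at *
  rw [abs_le] at e2
  constructor <;> linarith [e1.1, e1.2, e2.1, e2.2]

/-! ### The explicit formula for the play -/

/-- The lower set of levels whose supremum is the play with threshold `r` and input `q`. -/
def playSet (r : ℝ) (q : ℝ → ℝ) (t : ℝ) : Set ℝ :=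
  {x | (x ≤ 0 ∧ ∀ τ ∈ Icc 0 t, x ≤ q τ + r) ∨
    ∃ s ∈ Icc 0 t, x ≤ q s - r ∧ ∀ τ ∈ Icc s t, x ≤ q τ + r}

/-- The explicit formula for the play with threshold `r` and input `q`. -/
def playFormula (r : ℝ) (q : ℝ → ℝ) (t : ℝ) : ℝ := sSup (playSet r q t)

section Formula

variable {r t C : ℝ} {q : ℝ → ℝ}

theorem neg_mem_playSet (ht : 0 ≤ t) (hq : ∀ τ ∈ Icc 0 t, |q τ| ≤ C) :
    -(C + |r|) ∈ playSet r q t := by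
  have hC : 0 ≤ C := (abs_nonneg _).trans (hq 0 ⟨le_rfl, ht⟩)
  refine Or.inl ⟨by linarith [abs_nonneg r], fun τ hτ => ?_⟩
  linarith [neg_abs_le r, (abs_le.1 (hq τ hτ)).1]

theorem playSet_le (hq : ∀ τ ∈ Icc 0 t, |q τ| ≤ C) (hC : 0 ≤ C) {x : ℝ}
    (hx : x ∈ playSet r q t) : x ≤ C + |r| := by
  rcases hx with hx | ⟨s, hs, hx, -⟩
  · linarith [hx.1, abs_nonneg r]
  · linarith [neg_abs_le r, (abs_le.1 (hq s hs)).2]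

theorem le_playFormula (ht : 0 ≤ t) (hq : ∀ τ ∈ Icc 0 t, |q τ| ≤ C) {x : ℝ}
    (hx : x ∈ playSet r q t) : x ≤ playFormula r q t :=
  le_csSup ⟨C + |r|, fun _ h => playSet_le hq ((abs_nonneg _).trans (hq 0 ⟨le_rfl, ht⟩)) h⟩ hx

theorem playFormula_le (ht : 0 ≤ t) (hq : ∀ τ ∈ Icc 0 t, |q τ| ≤ C) {c : ℝ}
    (h : ∀ x ∈ playSet r q t, x ≤ c) : playFormula r q t ≤ c :=
  csSup_le ⟨_, neg_mem_playSet ht hq⟩ h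

theorem playFormula_congr {q' : ℝ → ℝ} (h : EqOn q q' (Icc 0 t)) :
    playFormula r q t = playFormula r q' t := by
  have : playSet r q t = playSet r q' t := by
    ext x
    refine or_congr (and_congr_right fun _ => forall₂_congr fun τ hτ => by rw [h hτ])
      (exists_congr fun s => and_congr_right fun hs => ?_)
    rw [h hs]
    refine and_congr_right fun _ => forall₂_congr fun τ hτ => ?_
    rw [h ⟨hs.1.trans hτ.1, hτ.2⟩]
  rw [playFormula, this, playFormula]

/-- The play is jointly Lipschitz in the threshold and the input. -/
theorem playFormula_le_add (ht : 0 ≤ t) {r' ε : ℝ} {q' : ℝ → ℝ}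
    (hq : ∀ τ ∈ Icc 0 t, |q τ| ≤ C) (hq' : ∀ τ ∈ Icc 0 t, |q' τ| ≤ C)
    (h : ∀ τ ∈ Icc 0 t, |q τ - q' τ| ≤ ε) :
    playFormula r q t ≤ playFormula r' q' t + (ε + |r - r'|) := by
  have hε : 0 ≤ ε := (abs_nonneg _).trans (h 0 ⟨le_rfl, ht⟩)
  have h1 := le_abs_self (r - r')
  have h2 := neg_abs_le (r - r')
  refine playFormula_le ht hq fun x hx => ?_
  rw [← sub_le_iff_le_add]
  refine le_playFormula ht hq' ?_
  rcases hx with ⟨hx0, hx⟩ | ⟨s, hs, hxs, hx⟩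
  · refine Or.inl ⟨by linarith [abs_nonneg (r - r')], fun τ hτ => ?_⟩
    linarith [hx τ hτ, (abs_le.1 (h τ hτ)).2]
  · refine Or.inr ⟨s, hs, by linarith [(abs_le.1 (h s hs)).2], fun τ hτ => ?_⟩
    linarith [hx τ hτ, (abs_le.1 (h τ ⟨hs.1.trans hτ.1, hτ.2⟩)).2]

theorem abs_playFormula_sub_le (ht : 0 ≤ t) {ε : ℝ} {q' : ℝ → ℝ}
    (hq : ∀ τ ∈ Icc 0 t, |q τ| ≤ C) (hq' : ∀ τ ∈ Icc 0 t, |q' τ| ≤ C)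
    (h : ∀ τ ∈ Icc 0 t, |q τ - q' τ| ≤ ε) :
    |playFormula r q t - playFormula r q' t| ≤ ε := by
  have h1 := playFormula_le_add (r := r) (r' := r) ht hq hq' h
  have h2 := playFormula_le_add (r := r) (r' := r) ht hq' hq
    (fun τ hτ => by rw [abs_sub_comm]; exact h τ hτ)
  rw [sub_self, abs_zero] at h1 h2
  rw [abs_le]; constructor <;> linarith

theorem abs_playFormula_sub_le_threshold (ht : 0 ≤ t) (hq : ∀ τ ∈ Icc 0 t, |q τ| ≤ C) (r' : ℝ) :
    |playFormula r q t - playFormula r' q t| ≤ |r - r'| := by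
  have h1 := playFormula_le_add (r := r) (r' := r') (ε := 0) ht hq hq (by simp)
  have h2 := playFormula_le_add (r := r') (r' := r) (ε := 0) ht hq hq (by simp)
  rw [abs_sub_comm r' r] at h2
  rw [abs_le]; constructor <;> linarith

theorem continuous_playFormula_threshold (ht : 0 ≤ t) (hq : ∀ τ ∈ Icc 0 t, |q τ| ≤ C) :
    Continuous fun r => playFormula r q t := by
  refine (LipschitzWith.of_dist_le_mul (K := 1) fun x y => ?_).continuous
  simpa [Real.dist_eq] using abs_playFormula_sub_le_threshold ht hq y

theorem abs_playFormula_le (ht : 0 ≤ t) (hr : 0 ≤ r) (hq : ∀ τ ∈ Icc 0 t, |q τ| ≤ C) :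
    |playFormula r q t| ≤ C := by
  have hC : 0 ≤ C := (abs_nonneg _).trans (hq 0 ⟨le_rfl, ht⟩)
  rw [abs_le]
  refine ⟨le_playFormula ht hq (Or.inl ⟨by linarith, fun τ hτ => ?_⟩),
    playFormula_le ht hq fun x hx => ?_⟩
  · linarith [(abs_le.1 (hq τ hτ)).1]
  · rcases hx with hx | ⟨s, hs, hx, -⟩
    · linarith [hx.1]
    · linarith [(abs_le.1 (hq s hs)).2]

end Formula

/-! ### Order and local descriptions of the play, and comparison -/

/-- Order-theoretic description of the play. -/
structure IsOrderPlay (T r : ℝ) (q ξ : ℝ → ℝ) : Prop where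
  abs_sub_le : ∀ t ∈ Icc 0 T, |q t - ξ t| ≤ r
  initial : ξ 0 = max (q 0 - r) (min 0 (q 0 + r))
  le_max : ∀ s t m, 0 ≤ s → s ≤ t → t ≤ T → (∀ τ ∈ Ioc s t, q τ - r ≤ m) → ξ t ≤ max (ξ s) m
  min_le : ∀ s t m, 0 ≤ s → s ≤ t → t ≤ T → (∀ τ ∈ Ioc s t, m ≤ q τ + r) → min (ξ s) m ≤ ξ t

theorem isOrderPlay_playFormula {T r C : ℝ} {q : ℝ → ℝ} (hT : 0 ≤ T) (hr : 0 ≤ r)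
    (hq : ∀ τ ∈ Icc 0 T, |q τ| ≤ C) : IsOrderPlay T r q (playFormula r q) := by
  have hq' : ∀ t ≤ T, ∀ τ ∈ Icc 0 t, |q τ| ≤ C := fun t ht τ hτ => hq τ ⟨hτ.1, hτ.2.trans ht⟩
  have hself : ∀ t ∈ Icc 0 T, q t - r ≤ playFormula r q t := fun t ht => by
    refine le_playFormula ht.1 (hq' t ht.2) (Or.inr ⟨t, ⟨ht.1, le_rfl⟩, le_rfl, fun τ hτ => ?_⟩)
    rw [le_antisymm hτ.2 hτ.1]; linarith
  refine ⟨fun t ht => ?_, ?_, ?_, ?_⟩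
  · have h1 := hself t ht
    have h2 : playFormula r q t ≤ q t + r := by
      refine playFormula_le ht.1 (hq' t ht.2) fun x hx => ?_
      rcases hx with ⟨-, hx⟩ | ⟨s, hs, -, hx⟩
      · exact hx t ⟨ht.1, le_rfl⟩
      · exact hx t ⟨hs.2, le_rfl⟩
    rw [abs_le]; constructor <;> linarith
  · refine le_antisymm (playFormula_le le_rfl (hq' 0 hT) fun x hx => ?_)
      (max_le (hself 0 ⟨le_rfl, hT⟩) (le_playFormula le_rfl (hq' 0 hT) (Or.inl ⟨min_le_left _ _,
        fun τ hτ => ?_⟩)))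
    · rcases hx with ⟨hx0, hx⟩ | ⟨s, hs, hx, -⟩
      · exact le_max_of_le_right (le_min hx0 (hx 0 ⟨le_rfl, le_rfl⟩))
      · rw [le_antisymm hs.2 hs.1] at hx
        exact le_max_of_le_left hx
    · rw [le_antisymm hτ.2 hτ.1]; exact min_le_right _ _
  · intro s t m hs hst ht hm
    refine playFormula_le (hs.trans hst) (hq' t ht) fun x hx => ?_
    rcases hx with ⟨hx0, hx⟩ | ⟨a, ha, hxa, hx⟩
    · exact le_max_of_le_left (le_playFormula hs (hq' s (hst.trans ht)) (Or.inl ⟨hx0,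
        fun τ hτ => hx τ ⟨hτ.1, hτ.2.trans hst⟩⟩))
    · rcases le_or_gt a s with h | h
      · exact le_max_of_le_left (le_playFormula hs (hq' s (hst.trans ht)) (Or.inr ⟨a, ⟨ha.1, h⟩,
          hxa, fun τ hτ => hx τ ⟨hτ.1, hτ.2.trans hst⟩⟩))
      · exact le_max_of_le_right (hxa.trans (hm a ⟨h, ha.2⟩))
  · intro s t m hs hst ht hm
    -- The supremum defining ξ s need not be attained; a level y strictly below it is dominated by
    -- an admissible level and survives until t.
    refine le_of_forall_lt_imp_le_of_dense fun y hy => ?_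
    rw [lt_min_iff] at hy
    obtain ⟨x, hx, hyx⟩ := exists_lt_of_lt_csSup ⟨_, neg_mem_playSet hs (hq' s (hst.trans ht))⟩ hy.1
    have aux : ∀ τ ∈ Ioc s t, y ≤ q τ + r := fun τ hτ => hy.2.le.trans (hm τ hτ)
    refine le_playFormula (hs.trans hst) (hq' t ht) ?_
    rcases hx with ⟨hx0, hx⟩ | ⟨a, ha, hxa, hx⟩
    · refine Or.inl ⟨hyx.le.trans hx0, fun τ hτ => ?_⟩
      rcases le_or_gt τ s with h | h
      · exact hyx.le.trans (hx τ ⟨hτ.1, h⟩)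
      · exact aux τ ⟨h, hτ.2⟩
    · refine Or.inr ⟨a, ⟨ha.1, ha.2.trans hst⟩, hyx.le.trans hxa, fun τ hτ => ?_⟩
      rcases le_or_gt τ s with h | h
      · exact hyx.le.trans (hx τ ⟨hτ.1, h⟩)
      · exact aux τ ⟨h, hτ.2⟩

theorem neg_clamp_zero (x : ℝ) {r : ℝ} (hr : 0 ≤ r) :
    -max (x - r) (min 0 (x + r)) = max (-x - r) (min 0 (-x + r)) := by
  rcases le_total 0 (x + r) with h | h <;> rcases le_total 0 (-x + r) with h' | h'
  · rw [min_eq_left h, min_eq_left h', max_eq_right, max_eq_right, neg_zero] <;> linarith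
  · rw [min_eq_left h, min_eq_right h', max_eq_left, max_eq_right] <;> linarith
  · rw [min_eq_right h, min_eq_left h', max_eq_right, max_eq_left] <;> linarith
  · rw [min_eq_right h, min_eq_right h', max_eq_right, max_eq_right] <;> linarith

theorem IsRightContRegulated.neg {T : ℝ} {f : ℝ → ℝ} (hf : IsRightContRegulated T f) :
    IsRightContRegulated T (fun t => -f t) :=
  ⟨⟨fun t ht => (hf.1.1 t ht).imp' Neg.neg fun _ h => h.neg,
    fun t ht => (hf.1.2 t ht).imp' Neg.neg fun _ h => h.neg⟩, fun t ht => (hf.2 t ht).neg⟩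

namespace IsOrderPlay

variable {T r : ℝ} {q ξ : ℝ → ℝ}

/-- The odd symmetry of the play; each lower bound below is the upper bound applied to -q. -/
theorem neg (h : IsOrderPlay T r q ξ) (hr : 0 ≤ r) :
    IsOrderPlay T r (fun t => -q t) (fun t => -ξ t) := by
  refine ⟨fun t ht => ?_, ?_, fun s t m hs hst ht hm => ?_, fun s t m hs hst ht hm => ?_⟩
  · have := h.abs_sub_le t ht
    rwa [abs_sub_comm, sub_neg_eq_add, neg_add_eq_sub]
  · rw [h.initial, neg_clamp_zero _ hr]
  · have := h.min_le s t (-m) hs hst ht fun τ hτ => by linarith [hm τ hτ]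
    rw [← neg_neg m, max_neg_neg]
    linarith
  · have := h.le_max s t (-m) hs hst ht fun τ hτ => by linarith [hm τ hτ]
    rw [← neg_neg m, min_neg_neg]
    linarith

theorem eventually_le_max (h : IsOrderPlay T r q ξ) (hq : IsRightContRegulated T q) {t : ℝ}
    (ht : t ∈ Ico 0 T) {ε : ℝ} (hε : 0 < ε) :
    ∀ᶠ x in 𝓝[≥] t, ξ x ≤ max (ξ t) (q t + ε - r) := by
  have h1 := (hq.2 t ht).eventually (gt_mem_nhds (show q t < q t + ε by linarith))
  obtain ⟨d, hd, hd'⟩ := (mem_nhdsGE_iff_exists_Ico_subset).1 h1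
  filter_upwards [Ico_mem_nhdsGE (show t < min d T from lt_min hd ht.2)] with x hx
  refine h.le_max t x _ ht.1 hx.1 (hx.2.le.trans (min_le_right _ _)) fun τ hτ => ?_
  have : q τ < q t + ε := hd' ⟨hτ.1.le, hτ.2.trans_lt (hx.2.trans_le (min_le_left _ _))⟩
  linarith

/-- Just before t the input stays within ε/2 of its left limit, so its pushing level q - r never
exceeds q s - r + ε ≤ ξ s + ε. Only the jump of q at t itself can push higher. -/
theorem eventually_left (h : IsOrderPlay T r q ξ) (hq : IsRightContRegulated T q) {t : ℝ}
    (ht : t ∈ Ioc 0 T) {ε : ℝ} (hε : 0 < ε) :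
    ∀ᶠ s in 𝓝[<] t, (∀ x ∈ Ioo s t, ξ x ≤ ξ s + ε) ∧ ξ t ≤ max (ξ s + ε) (q t - r) := by
  obtain ⟨l, hl⟩ := hq.1.2 t ht
  obtain ⟨d, hd, hd'⟩ := (mem_nhdsLT_iff_exists_Ioo_subset).1
    (hl.eventually (Metric.ball_mem_nhds l (half_pos hε)))
  have key : ∀ x ∈ Ioo d t, |q x - l| < ε / 2 := fun x hx => by
    simpa [Real.dist_eq] using hd' hx
  filter_upwards [Ioo_mem_nhdsLT (show max d 0 < t from max_lt hd ht.1)] with s hs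
  have hs1 := max_lt_iff.1 hs.1
  have e1 := abs_lt.1 (key s ⟨hs1.1, hs.2⟩)
  have e2 := abs_le.1 (h.abs_sub_le s ⟨hs1.2.le, hs.2.le.trans ht.2⟩)
  refine ⟨fun x hx => ?_, ?_⟩
  · refine (h.le_max s x (l + ε / 2 - r) hs1.2.le hx.1.le (hx.2.le.trans ht.2)
      fun τ hτ => ?_).trans (max_le (by linarith) (by linarith))
    linarith [abs_lt.1 (key τ ⟨hs1.1.trans hτ.1, hτ.2.trans_lt hx.2⟩)]
  · refine (h.le_max s t (max (l + ε / 2 - r) (q t - r)) hs1.2.le hs.2.le ht.2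
      fun τ hτ => ?_).trans (max_le (le_max_of_le_left (by linarith))
        (max_le_max_right _ (by linarith)))
    rcases hτ.2.eq_or_lt with h' | h'
    · rw [h']; exact le_max_right _ _
    · exact le_max_of_le_left
        (by linarith [abs_lt.1 (key τ ⟨hs1.1.trans hτ.1, h'⟩)])

end IsOrderPlay

/-- Local description of the play. -/
structure IsLocalPlay (T r : ℝ) (q ξ : ℝ → ℝ) : Prop where
  abs_sub_le : ∀ t ∈ Icc 0 T, |q t - ξ t| ≤ r
  initial : ξ 0 = max (q 0 - r) (min 0 (q 0 + r))
  rightCont : ∀ t ∈ Ico 0 T, ContinuousWithinAt ξ (Ici t) t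
  left : ∀ t ∈ Ioc 0 T, ∃ l, Tendsto ξ (𝓝[<] t) (𝓝 l) ∧
    (q t - ξ t < r → ξ t ≤ l) ∧ (-r < q t - ξ t → l ≤ ξ t)
  right_le : ∀ t ∈ Ico 0 T, q t - ξ t < r → ∀ᶠ x in 𝓝[>] t, ξ x ≤ ξ t
  right_ge : ∀ t ∈ Ico 0 T, -r < q t - ξ t → ∀ᶠ x in 𝓝[>] t, ξ t ≤ ξ x

theorem IsOrderPlay.isLocalPlay {T r : ℝ} {q ξ : ℝ → ℝ} (h : IsOrderPlay T r q ξ) (hr : 0 ≤ r)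
    (hq : IsRightContRegulated T q) : IsLocalPlay T r q ξ := by
  have h' := h.neg hr
  have hq' := hq.neg
  refine ⟨h.abs_sub_le, h.initial, fun t ht => ?_, fun t ht => ?_, fun t ht hlt => ?_,
    fun t ht hlt => ?_⟩
  · rw [ContinuousWithinAt, Metric.tendsto_nhds]
    intro ε hε
    have e := abs_le.1 (h.abs_sub_le t ⟨ht.1, ht.2.le⟩)
    filter_upwards [h.eventually_le_max hq ht (half_pos hε),
      h'.eventually_le_max hq' ht (half_pos hε)] with x h1 h2
    have h3 : ξ x ≤ ξ t + ε / 2 := h1.trans (max_le (by linarith) (by linarith))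
    have h4 : -ξ x ≤ -ξ t + ε / 2 := h2.trans (max_le (by linarith) (by linarith))
    rw [Real.dist_eq, abs_lt]
    constructor <;> linarith
  · have hlim : ∃ l, Tendsto ξ (𝓝[<] t) (𝓝 l) := by
      -- The left limit exists by Cauchy's criterion, from the two one-sided bounds for q and -q.
      rw [← cauchy_map_iff_exists_tendsto, Metric.cauchy_iff]
      refine ⟨inferInstance, fun ε hε => ?_⟩
      have := (h.eventually_left hq ht (half_pos hε)).and (h'.eventually_left hq' ht (half_pos hε))
      obtain ⟨d, hd, hd'⟩ := (mem_nhdsLT_iff_exists_Ioo_subset).1 this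
      have key : ∀ x ∈ Ioo d t, ∀ y ∈ Ioo d t, x < y → |ξ x - ξ y| < ε := by
        intro x hx y hy hxy
        have h1 := (hd' hx).1.1 y ⟨hxy, hy.2⟩
        have h2 := (hd' hx).2.1 y ⟨hxy, hy.2⟩
        rw [abs_lt]; constructor <;> linarith
      refine ⟨ξ '' Ioo d t, image_mem_map (Ioo_mem_nhdsLT hd), ?_⟩
      rintro _ ⟨x, hx, rfl⟩ _ ⟨y, hy, rfl⟩
      rw [Real.dist_eq]
      rcases lt_trichotomy x y with hxy | hxy | hxy
      · exact key x hx y hy hxy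
      · rw [hxy, sub_self, abs_zero]; exact hε
      · rw [abs_sub_comm]; exact key y hy x hx hxy
    obtain ⟨l, hl⟩ := hlim
    refine ⟨l, hl, fun hlt => ?_, fun hlt => ?_⟩
    · refine le_of_forall_pos_le_add fun ε hε => ?_
      refine ge_of_tendsto (hl.add_const ε) ?_
      filter_upwards [h.eventually_left hq ht hε] with s hs
      exact (le_max_iff.1 hs.2).resolve_right (by linarith)
    · refine le_of_forall_pos_le_add fun ε hε => ?_
      refine le_of_tendsto hl ?_
      filter_upwards [h'.eventually_left hq' ht hε] with s hs
      have := (le_max_iff.1 hs.2).resolve_right (by linarith)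
      linarith
  · have := h.eventually_le_max hq ht (show 0 < r - (q t - ξ t) by linarith)
    filter_upwards [this.filter_mono (nhdsWithin_mono t Ioi_subset_Ici_self)] with x hx
    exact hx.trans (max_le le_rfl (by linarith))
  · have := h'.eventually_le_max hq' ht (show 0 < r + (q t - ξ t) by linarith)
    filter_upwards [this.filter_mono (nhdsWithin_mono t Ioi_subset_Ici_self)] with x hx
    have := hx.trans (max_le le_rfl (by linarith))
    linarith

namespace IsLocalPlay

variable {T r : ℝ} {q ξ : ℝ → ℝ}

theorem isRightContRegulated (h : IsLocalPlay T r q ξ) : IsRightContRegulated T ξ :=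
  ⟨⟨fun t ht => ⟨ξ t, (h.rightCont t ht).mono Ioi_subset_Ici_self⟩,
    fun t ht => let ⟨l, hl, _⟩ := h.left t ht; ⟨l, hl⟩⟩, h.rightCont⟩

/-- The barrier principle at level ξ s: without contact with the boundary q - ξ = r, the play cannot
rise. -/
theorem le_of_forall_lt (h : IsLocalPlay T r q ξ) {s t : ℝ} (hs : 0 ≤ s) (hst : s ≤ t)
    (ht : t ≤ T) (H : ∀ τ ∈ Ioc s t, q τ - ξ τ < r) : ξ t ≤ ξ s := by
  refine barrier (a := s) (b := t) le_rfl
    (fun x hx => h.rightCont x ⟨hs.trans hx.1, hx.2.trans_le ht⟩)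
    (fun x hx hlt => ?_) (fun x hx _ => ?_) t ⟨hst, le_rfl⟩
  · refine h.right_le x ⟨hs.trans hx.1, hx.2.trans_le ht⟩ (H x ⟨lt_of_le_of_ne hx.1 ?_, hx.2.le⟩)
    rintro rfl
    exact lt_irrefl _ hlt
  · obtain ⟨l, hl, h1, -⟩ := h.left x ⟨hs.trans_lt hx.1, hx.2.trans ht⟩
    exact ⟨l, hl, h1 (H x hx)⟩

theorem ge_of_forall_gt (h : IsLocalPlay T r q ξ) {s t : ℝ} (hs : 0 ≤ s) (hst : s ≤ t)
    (ht : t ≤ T) (H : ∀ τ ∈ Ioc s t, -r < q τ - ξ τ) : ξ s ≤ ξ t := by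
  have := barrier (a := s) (b := t) (f := fun x => -ξ x) le_rfl
    (fun x hx => (h.rightCont x ⟨hs.trans hx.1, hx.2.trans_le ht⟩).neg)
    (fun x hx hlt => ?_) (fun x hx _ => ?_) t ⟨hst, le_rfl⟩
  · linarith
  · have hsx : s < x := lt_of_le_of_ne hx.1 (by rintro rfl; exact lt_irrefl _ hlt)
    exact (h.right_ge x ⟨hs.trans hx.1, hx.2.trans_le ht⟩ (H x ⟨hsx, hx.2.le⟩)).mono
      fun y hy => neg_le_neg hy
  · obtain ⟨l, hl, -, h1⟩ := h.left x ⟨hs.trans_lt hx.1, hx.2.trans ht⟩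
    exact ⟨-l, hl.neg, neg_le_neg (h1 (H x hx))⟩

/-- Comparison principle for two plays. -/
theorem sub_le {q' ξ' : ℝ → ℝ} (h : IsLocalPlay T r q ξ) (h' : IsLocalPlay T r q' ξ') {c : ℝ}
    (hc : 0 ≤ c) (H : ∀ t ∈ Icc 0 T, c < ξ t - ξ' t → q t - ξ t < r ∧ -r < q' t - ξ' t) :
    ∀ t ∈ Icc 0 T, ξ t - ξ' t ≤ c := by
  intro t₀ ht₀
  have hT : 0 ≤ T := ht₀.1.trans ht₀.2
  refine barrier (f := fun t => ξ t - ξ' t) ?_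
    (fun t ht => (h.rightCont t ht).sub (h'.rightCont t ht)) (fun t ht hlt => ?_)
    (fun t ht hlt => ?_) t₀ ht₀
  · by_contra hlt
    obtain ⟨h1, h2⟩ := H 0 ⟨le_rfl, hT⟩ (not_le.1 hlt)
    have e1 := h.initial
    have e2 := h'.initial
    -- Off the two boundaries, the formula for the initial value leaves only ξ 0 ≤ 0 and, for the
    -- second play, ξ' 0 ≥ 0; this excludes an initial difference above c ≥ 0.
    have e3 : ξ 0 ≤ 0 := by
      have := (le_max_iff.1 e1.le).resolve_left (by linarith)
      exact this.trans (min_le_left _ _)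
    have e4 : 0 ≤ ξ' 0 := by
      rw [e2]
      refine le_max_of_le_right (le_min le_rfl ?_)
      by_contra hneg
      rw [min_eq_right (not_le.1 hneg).le] at e2
      linarith [le_max_right (q' 0 - r) (q' 0 + r), abs_le.1 (h'.abs_sub_le 0 ⟨le_rfl, hT⟩)]
    exact hlt (by linarith)
  · obtain ⟨h1, h2⟩ := H t (Ico_subset_Icc_self ht) hlt
    filter_upwards [h.right_le t ht h1, h'.right_ge t ht h2] with x hx hx'
    linarith
  · obtain ⟨h1, h2⟩ := H t (Ioc_subset_Icc_self ht) hlt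
    obtain ⟨l, hl, hl1, -⟩ := h.left t ht
    obtain ⟨l', hl', -, hl2⟩ := h'.left t ht
    exact ⟨l - l', hl.sub hl', by linarith [hl1 h1, hl2 h2]⟩

/-- With a common input, ξ > ξ' already forces q - ξ < r and -r < q - ξ', so the comparison
principle applies with c = 0 in both directions. -/
theorem eqOn {ξ' : ℝ → ℝ} (h : IsLocalPlay T r q ξ) (h' : IsLocalPlay T r q ξ') :
    EqOn ξ ξ' (Icc 0 T) := by
  intro t ht
  have h1 := h.sub_le h' le_rfl (fun s hs hlt => by
    have e1 := abs_le.1 (h.abs_sub_le s hs)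
    have e2 := abs_le.1 (h'.abs_sub_le s hs)
    constructor <;> linarith) t ht
  have h2 := h'.sub_le h le_rfl (fun s hs hlt => by
    have e1 := abs_le.1 (h.abs_sub_le s hs)
    have e2 := abs_le.1 (h'.abs_sub_le s hs)
    constructor <;> linarith) t ht
  linarith

end IsLocalPlay

/-! ### Equivalence with the variational inequality -/

theorem isRegulated_of_monotone {T : ℝ} {f : ℝ → ℝ} (hf : Monotone f) : IsRegulated T f :=
  ⟨fun _ _ => ⟨_, hf.tendsto_nhdsGT _⟩, fun _ _ => ⟨_, hf.tendsto_nhdsLT _⟩⟩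

theorem IsRegulated.const_mul {T : ℝ} {f : ℝ → ℝ} (hf : IsRegulated T f) (k : ℝ) :
    IsRegulated T (fun t => k * f t) :=
  ⟨fun t ht => (hf.1 t ht).imp' (k * ·) fun _ h => h.const_mul k,
    fun t ht => (hf.2 t ht).imp' (k * ·) fun _ h => h.const_mul k⟩

theorem monotone_indicator_Ici (c : ℝ) : Monotone ((Ici c).indicator (1 : ℝ → ℝ)) := by
  intro x y hxy
  by_cases h : c ≤ x
  · simp [h, h.trans hxy]
  · simp only [indicator_of_notMem (show x ∉ Ici c from h)]
    exact indicator_nonneg (fun _ _ => zero_le_one) _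

theorem monotone_indicator_Ioi (c : ℝ) : Monotone ((Ioi c).indicator (1 : ℝ → ℝ)) := by
  intro x y hxy
  by_cases h : c < x
  · simp [h, h.trans_le hxy]
  · simp only [indicator_of_notMem (show x ∉ Ioi c from h)]
    exact indicator_nonneg (fun _ _ => zero_le_one) _

theorem isRegulated_indicator_singleton (T c : ℝ) :
    IsRegulated T (({c} : Set ℝ).indicator 1) := by
  convert! (isRegulated_of_monotone (T := T) (monotone_indicator_Ici c)).sub
    (isRegulated_of_monotone (T := T) (monotone_indicator_Ioi c)) using 1
  ext x
  rcases lt_trichotomy x c with h | h | h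
  · simp [h.not_ge, h.not_gt, h.ne]
  · simp [h]
  · simp [h, h.le, h.ne']

theorem isRegulated_indicator_Ioc (T : ℝ) {c d : ℝ} (hcd : c ≤ d) :
    IsRegulated T ((Ioc c d).indicator 1) := by
  convert! (isRegulated_of_monotone (T := T) (monotone_indicator_Ioi c)).sub
    (isRegulated_of_monotone (T := T) (monotone_indicator_Ioi d)) using 1
  ext x
  by_cases h1 : x ≤ c
  · simp [h1.not_gt, (h1.trans hcd)]
  · by_cases h2 : x ≤ d
    · simp [not_le.1 h1, h2]
    · simp [not_le.1 h1, not_le.1 h2, h2]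

namespace IsPlay

variable {T r : ℝ} {q ξ : ℝ → ℝ}

/-- The variational inequality tested with z = q - ξ - f, so that the integrand becomes f. Choosing
f as a multiple of an indicator extracts information on a point or an interval. -/
theorem integral_nonneg (h : IsPlay T r q ξ) (hT : 0 ≤ T) (hq : IsRegulated T q) {f : ℝ → ℝ}
    (hf : IsRegulated T f) (hfr : ∀ t ∈ Icc 0 T, |q t - ξ t - f t| ≤ r) {I : ℝ}
    (hI : HasKSIntegral f ξ 0 T I) : 0 ≤ I := by
  obtain ⟨I', hI', h0⟩ := h.variational (fun t => q t - ξ t - f t)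
    ((hq.sub h.rightContinuous.1).sub hf) hfr
  simp only [sub_sub_cancel] at hI'
  rwa [hI.unique hT hI']

theorem le_leftLimit (h : IsPlay T r q ξ) (hq : IsRegulated T q) {t l k : ℝ}
    (ht : t ∈ Ioc 0 T) (hl : Tendsto ξ (𝓝[<] t) (𝓝 l)) (hk : |q t - ξ t - k| ≤ r) :
    0 ≤ k * (ξ t - l) := by
  have hT := ht.1.le.trans ht.2
  refine h.integral_nonneg hT hq ((isRegulated_indicator_singleton T t).const_mul k)
    (fun x hx => ?_) ((HasKSIntegral.single ht h.rightContinuous.2 hl).const_mul k)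
  by_cases hxt : x = t
  · subst hxt
    simpa using hk
  · simpa [hxt] using h.abs_sub_le x hx

theorem right_increment (h : IsPlay T r q ξ) (hq : IsRegulated T q) {s t k : ℝ}
    (hs : 0 ≤ s) (hst : s ≤ t) (ht : t ≤ T) (hk : ∀ x ∈ Ioc s t, |q x - ξ x - k| ≤ r) :
    0 ≤ k * (ξ t - ξ s) := by
  refine h.integral_nonneg (hs.trans (hst.trans ht)) hq
    ((isRegulated_indicator_Ioc T hst).const_mul k)
    (fun x hx => ?_)
    ((HasKSIntegral.indicator_Ioc hs hst ht h.rightContinuous.2).const_mul k)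
  by_cases hxt : x ∈ Ioc s t
  · simpa [indicator_of_mem hxt] using hk x hxt
  · simpa [indicator_of_notMem hxt] using h.abs_sub_le x hx

theorem isLocalPlay (h : IsPlay T r q ξ) (hr : 0 < r) (hq : IsRightContRegulated T q) :
    IsLocalPlay T r q ξ := by
  refine ⟨h.abs_sub_le, h.initial, h.rightContinuous.2, fun t ht => ?_, fun t ht hlt => ?_,
    fun t ht hlt => ?_⟩
  · obtain ⟨l, hl⟩ := h.rightContinuous.1.2 t ht
    refine ⟨l, hl, fun hlt => ?_, fun hlt => ?_⟩
    -- This k corresponds to the extreme test value z t = r, and it is negative because q t - ξ t <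
    -- r.
    · have := h.le_leftLimit hq.1 ht hl (k := q t - ξ t - r) (by rw [sub_sub_cancel, abs_of_pos hr])
      nlinarith
    · have := h.le_leftLimit hq.1 ht hl (k := q t - ξ t + r)
        (by rw [sub_add_cancel_left, abs_neg, abs_of_pos hr])
      nlinarith
  · have hc : ContinuousWithinAt (fun x => q x - ξ x) (Ici t) t :=
      (hq.2 t ht).sub (h.rightContinuous.2 t ht)
    obtain ⟨η, hη, hη'⟩ : ∃ η > 0, q t - ξ t < r - η :=
      ⟨(r - (q t - ξ t)) / 2, by linarith, by linarith⟩
    obtain ⟨d, hd, hd'⟩ := (mem_nhdsGE_iff_exists_Ico_subset).1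
      (hc.eventually (gt_mem_nhds hη'))
    filter_upwards [Ioo_mem_nhdsGT (show t < min d T from lt_min hd ht.2)] with x hx
    have hx2 := lt_min_iff.1 hx.2
    have := h.right_increment hq.1 (k := -min η r) ht.1 hx.1.le hx2.2.le fun y hy => by
      have e1 : q y - ξ y < r - η := hd' ⟨hy.1.le, hy.2.trans_lt hx2.1⟩
      have e2 := abs_le.1 (h.abs_sub_le y ⟨ht.1.trans hy.1.le, hy.2.trans hx2.2.le⟩)
      have e3 := min_le_left η r
      have e4 : 0 < min η r := lt_min hη hr
      rw [abs_le]; constructor <;> linarith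
    have e4 : 0 < min η r := lt_min hη hr
    nlinarith
  · have hc : ContinuousWithinAt (fun x => q x - ξ x) (Ici t) t :=
      (hq.2 t ht).sub (h.rightContinuous.2 t ht)
    obtain ⟨η, hη, hη'⟩ : ∃ η > 0, -r + η < q t - ξ t :=
      ⟨(r + (q t - ξ t)) / 2, by linarith, by linarith⟩
    obtain ⟨d, hd, hd'⟩ := (mem_nhdsGE_iff_exists_Ico_subset).1
      (hc.eventually (lt_mem_nhds hη'))
    filter_upwards [Ioo_mem_nhdsGT (show t < min d T from lt_min hd ht.2)] with x hx
    have hx2 := lt_min_iff.1 hx.2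
    have := h.right_increment hq.1 (k := η) ht.1 hx.1.le hx2.2.le fun y hy => by
      have e1 : -r + η < q y - ξ y := hd' ⟨hy.1.le, hy.2.trans_lt hx2.1⟩
      have e2 := abs_le.1 (h.abs_sub_le y ⟨ht.1.trans hy.1.le, hy.2.trans hx2.2.le⟩)
      rw [abs_le]; constructor <;> linarith
    nlinarith

end IsPlay

theorem boundedVariationOn_Icc_of_Ico {f : ℝ → ℝ} {s t l : ℝ} (hst : s < t)
    (hl : Tendsto f (𝓝[<] t) (𝓝 l)) (h : BoundedVariationOn f (Ico s t)) :
    BoundedVariationOn f (Icc s t) := by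
  have hs : Ici s ∩ Iio t = Ico s t := rfl
  have hne : (𝓝[Ico s t] t).NeBot := by
    rw [← mem_closure_iff_nhdsWithin_neBot, closure_Ico hst.ne]
    exact ⟨hst.le, le_rfl⟩
  have := eVariationOn.eVariationOn_on_inter_Iic_eq_Iio_add_edist (s := Ici s) (a := t) (f := f)
    (l := l) hne hst.le (hl.mono_left (nhdsWithin_mono _ fun x hx => hx.2))
  change eVariationOn f (Ici s ∩ Iic t) ≠ ⊤
  rw [this, hs]
  exact ENNReal.add_ne_top.2 ⟨h, edist_ne_top _ _⟩

theorem boundedVariationOn_Icc_union {f : ℝ → ℝ} {a s t : ℝ} (has : a ≤ s) (hst : s ≤ t)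
    (h1 : BoundedVariationOn f (Icc a s)) (h2 : BoundedVariationOn f (Icc s t)) :
    BoundedVariationOn f (Icc a t) := by
  have := eVariationOn.Icc_add_Icc f (s := univ) has hst (mem_univ _)
  simp only [univ_inter] at this
  rw [BoundedVariationOn, ← this]
  exact ENNReal.add_ne_top.2 ⟨h1, h2⟩

theorem IsOrderPlay.boundedVariationOn {T r : ℝ} {q ξ : ℝ → ℝ} (h : IsOrderPlay T r q ξ)
    (hT : 0 ≤ T) (hr : 0 < r) (hq : IsRightContRegulated T q) :
    BoundedVariationOn ξ (Icc 0 T) := by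
  have hl := h.isLocalPlay hr.le hq
  obtain ⟨C, hC⟩ := hl.isRightContRegulated.1.exists_bound hT
  refine hq.1.induction hT hr (P := fun t => BoundedVariationOn ξ (Icc 0 t)) ?_ ?_
  · rw [Icc_self]; exact BoundedVariationOn.of_subsingleton subsingleton_singleton
  · intro s t hs hst ht hosc hP
    refine boundedVariationOn_Icc_union hs hst.le hP ?_
    obtain ⟨l, hlim, -⟩ := hl.left t ⟨hs.trans_lt hst, ht⟩
    refine boundedVariationOn_Icc_of_Ico hst hlim ?_
    have hbd : ∀ x ∈ Ico s t, |ξ x| ≤ C := fun x hx => hC x ⟨hs.trans hx.1, hx.2.le.trans ht⟩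
    have key : (∀ x ∈ Ioo s t, q x - ξ x < r) ∨ ∀ x ∈ Ioo s t, -r < q x - ξ x := by
      by_contra! hcon
      obtain ⟨⟨x, hx, hxr⟩, y, hy, hyr⟩ := hcon
      rcases lt_trichotomy x y with hxy | hxy | hxy
      -- From x to y all pushing levels q τ - r lie below q y, and ξ x ≤ q x - r ≤ q y; so ξ y ≤ q
      -- y, against ξ y ≥ q y + r.
      · have := h.le_max x y (q y) (hs.trans hx.1.le) hxy.le (hy.2.le.trans ht) fun τ hτ => by
          linarith [abs_le.1 (hosc τ ⟨hx.1.trans hτ.1, hτ.2.trans_lt hy.2⟩ y hy)]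
        rcases le_max_iff.1 this with h' | h'
        · linarith [abs_le.1 (hosc x hx y hy)]
        · linarith
      · subst hxy; linarith
      · have := h.min_le y x (q x) (hs.trans hy.1.le) hxy.le (hx.2.le.trans ht) fun τ hτ => by
          linarith [abs_le.1 (hosc τ ⟨hy.1.trans hτ.1, hτ.2.trans_lt hx.2⟩ x hx)]
        rcases min_le_iff.1 this with h' | h'
        · linarith [abs_le.1 (hosc x hx y hy)]
        · linarith
    rcases key with key | key
    · have : MonotoneOn (fun x => -ξ x) (Ico s t) := fun x hx y hy hxy =>
        neg_le_neg (hl.le_of_forall_lt (hs.trans hx.1) hxy (hy.2.le.trans ht)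
          fun τ hτ => key τ ⟨hx.1.trans_lt hτ.1, hτ.2.trans_lt hy.2⟩)
      have h2 := this.boundedVariationOn (C := C) fun x hx => by rw [abs_neg]; exact hbd x hx
      have h3 := (isometry_neg (G := ℝ)).lipschitz.comp_boundedVariationOn h2
      simpa [Function.comp_def] using h3
    · have : MonotoneOn ξ (Ico s t) := fun x hx y hy hxy =>
        hl.ge_of_forall_gt (hs.trans hx.1) hxy (hy.2.le.trans ht)
          fun τ hτ => key τ ⟨hx.1.trans_lt hτ.1, hτ.2.trans_lt hy.2⟩
      exact this.boundedVariationOn hbd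

/-- A net rise of ξ requires a contact q - ξ ≥ r, a net fall a contact q - ξ ≤ -r. At that point the
integrand has the sign of the increment for every admissible z. -/
theorem IsLocalPlay.exists_sign {T r : ℝ} {q ξ z : ℝ → ℝ} (h : IsLocalPlay T r q ξ)
    (hz : ∀ t ∈ Icc 0 T, |z t| ≤ r) {s t l : ℝ} (hs : 0 ≤ s) (hst : s < t) (ht : t ≤ T)
    (hl : Tendsto ξ (𝓝[<] t) (𝓝 l)) :
    ∃ c ∈ Ioo s t, 0 ≤ (q c - ξ c - z c) * (l - ξ s) := by
  have hz' : ∀ x ∈ Ioo s t, |z x| ≤ r := fun x hx => hz x ⟨hs.trans hx.1.le, hx.2.le.trans ht⟩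
  rcases lt_trichotomy l (ξ s) with hlt | heq | hgt
  · obtain ⟨x, hx1, hx⟩ := ((hl.eventually (gt_mem_nhds hlt)).and (Ioo_mem_nhdsLT hst)).exists
    have : ¬ ∀ τ ∈ Ioc s x, -r < q τ - ξ τ := fun H =>
      absurd (h.ge_of_forall_gt hs hx.1.le (hx.2.le.trans ht) H) (not_le.2 hx1)
    push Not at this
    obtain ⟨c, hc, hcr⟩ := this
    have hc' : c ∈ Ioo s t := ⟨hc.1, hc.2.trans_lt hx.2⟩
    refine ⟨c, hc', mul_nonneg_of_nonpos_of_nonpos ?_ (by linarith)⟩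
    linarith [abs_le.1 (hz' c hc')]
  · obtain ⟨c, hc⟩ := exists_between hst
    exact ⟨c, hc, by simp [heq]⟩
  · obtain ⟨x, hx1, hx⟩ := ((hl.eventually (lt_mem_nhds hgt)).and (Ioo_mem_nhdsLT hst)).exists
    have : ¬ ∀ τ ∈ Ioc s x, q τ - ξ τ < r := fun H =>
      absurd (h.le_of_forall_lt hs hx.1.le (hx.2.le.trans ht) H) (not_le.2 hx1)
    push Not at this
    obtain ⟨c, hc, hcr⟩ := this
    have hc' : c ∈ Ioo s t := ⟨hc.1, hc.2.trans_lt hx.2⟩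
    refine ⟨c, hc', mul_nonneg ?_ (by linarith)⟩
    linarith [abs_le.1 (hz' c hc')]

/-- The integrand is approximated uniformly by step functions whose value on each open interval is
sampled at a point supplied by `exists_sign`. Every term of the resulting integral, including those
from the jumps of ξ, is then nonnegative. -/
theorem IsLocalPlay.isPlay {T r : ℝ} {q ξ : ℝ → ℝ} (h : IsLocalPlay T r q ξ)
    (hT : 0 ≤ T) (hq : IsRightContRegulated T q) (hbv : BoundedVariationOn ξ (Icc 0 T)) :
    IsPlay T r q ξ := by
  refine ⟨hbv, h.isRightContRegulated, h.abs_sub_le, fun z hz hzr => ?_, h.initial⟩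
  refine exists_hasKSIntegral_of_approx hT hbv fun ε hε => ?_
  set f : ℝ → ℝ := fun t => q t - ξ t - z t with hf
  have hfr : IsRegulated T f := (hq.1.sub h.isRightContRegulated.1).sub hz
  -- Vanishing to the right of the endpoint lets the next step be added without altering what has
  -- been built.
  suffices H : ∃ (g : ℝ → ℝ) (I : ℝ), HasKSIntegral g ξ 0 T I ∧ 0 ≤ I ∧
      (∀ x ∈ Icc 0 T, |g x - f x| ≤ ε) ∧ ∀ x, T < x → g x = 0 by
    obtain ⟨g, I, h1, h2, h3, -⟩ := H
    exact ⟨g, I, h1, h2, h3⟩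
  refine hfr.induction hT hε (P := fun t => ∃ (g : ℝ → ℝ) (I : ℝ), HasKSIntegral g ξ 0 T I ∧
    0 ≤ I ∧ (∀ x ∈ Icc 0 t, |g x - f x| ≤ ε) ∧ ∀ x, t < x → g x = 0) ?_ ?_
  · refine ⟨_, _, (HasKSIntegral.indicator_Iic (c := 0) ⟨le_rfl, hT⟩ h.rightCont).const_mul (f 0),
      by simp, fun x hx => ?_, fun x hx => ?_⟩
    · rw [le_antisymm hx.2 hx.1]; simpa using hε.le
    · simp [hx.not_ge]
  · rintro s t hs hst ht hosc ⟨g, I, h1, h2, h3, h4⟩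
    obtain ⟨l, hl, hl1, hl2⟩ := h.left t ⟨hs.trans_lt hst, ht⟩
    obtain ⟨c, hc, hc0⟩ := h.exists_sign hzr hs hst ht hl
    refine ⟨_, _, (h1.add ((HasKSIntegral.indicator_Ioo hs hst ht h.rightCont hl).const_mul
      (f c))).add ((HasKSIntegral.single ⟨hs.trans_lt hst, ht⟩ h.rightCont hl).const_mul (f t)),
      ?_, fun x hx => ?_, fun x hx => ?_⟩
    · have htT : t ∈ Icc 0 T := ⟨hs.trans hst.le, ht⟩
      have hzt := abs_le.1 (hzr t htT)
      have : 0 ≤ f t * (ξ t - l) := by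
        rcases lt_trichotomy (ξ t) l with hlt | heq | hgt
        · refine mul_nonneg_of_nonpos_of_nonpos ?_ (by linarith)
          have : ¬ -r < q t - ξ t := fun h' => absurd (hl2 h') (not_le.2 hlt)
          simp only [hf]; linarith
        · simp [heq]
        · refine mul_nonneg ?_ (by linarith)
          have : ¬ q t - ξ t < r := fun h' => absurd (hl1 h') (not_le.2 hgt)
          simp only [hf]; linarith
      have hc0' : 0 ≤ f c * (l - ξ s) := hc0
      linarith
    · rcases le_or_gt x s with hxs | hxs
      · have e1 : x ∉ Ioo s t := fun h' => absurd h'.1 (not_lt.2 hxs)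
        have e2 : x ∉ ({t} : Set ℝ) := (hxs.trans_lt hst).ne
        simpa only [indicator_of_notMem e1, indicator_of_notMem e2, mul_zero, add_zero]
          using h3 x ⟨hx.1, hxs⟩
      · rw [h4 x hxs]
        rcases hx.2.eq_or_lt with hxt | hxt
        · subst hxt; simpa using hε.le
        · have e1 : x ∈ Ioo s t := ⟨hxs, hxt⟩
          have e2 : x ∉ ({t} : Set ℝ) := hxt.ne
          simpa [indicator_of_mem e1, indicator_of_notMem e2] using hosc c hc x e1
    · simp [h4 x (hst.trans hx), hx.not_gt, hx.ne']

/-- The play operator is given by the explicit formula. -/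
theorem play_eqOn_playFormula {T r : ℝ} (hT : 0 ≤ T) (hr : 0 < r) {q : ℝ → ℝ}
    (hq : IsRightContRegulated T q) : EqOn (play T r q) (playFormula r q) (Icc 0 T) := by
  obtain ⟨C, hC⟩ := hq.1.exists_bound hT
  have h1 := isOrderPlay_playFormula hT hr.le hC
  have h2 := h1.isLocalPlay hr.le hq
  have h3 : IsPlay T r q (play T r q) :=
    Classical.epsilon_spec ⟨_, h2.isPlay hT hq (h1.boundedVariationOn hT hr hq)⟩
  exact (h3.isLocalPlay hr hq).eqOn h2

/-! ### Measurability of the density and bounds for the Preisach functional -/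

theorem volume_restrict_Ioi_prod_univ :
    (volume : Measure (ℝ × ℝ)).restrict (Ioi (0 : ℝ) ×ˢ univ) =
      (volume.restrict (Ioi (0 : ℝ))).prod volume := by
  rw [Measure.restrict_prod_eq_prod_univ, Measure.volume_eq_prod]

/-- Differentiability everywhere matters: the bounded derivative is then integrable and the
fundamental theorem of calculus holds, whereas differentiability almost everywhere would not
suffice. -/
theorem abs_sub_le_of_ae_deriv_le {f : ℝ → ℝ} {C : ℝ} (hf : Differentiable ℝ f)
    (hC : ∀ᵐ θ : ℝ, |deriv f θ| ≤ C) : |f 1 - f 0| ≤ C := by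
  have hint : IntervalIntegrable (deriv f) volume 0 1 := by
    rw [intervalIntegrable_iff]
    refine Measure.integrableOn_of_bounded (M := C) (by simp)
      (measurable_deriv f).aestronglyMeasurable (ae_restrict_of_ae ?_)
    simpa only [Real.norm_eq_abs] using hC
  rw [← intervalIntegral.integral_deriv_eq_sub (fun x _ => hf x) hint, ← Real.norm_eq_abs]
  have := intervalIntegral.norm_integral_le_of_norm_le_const_ae (a := 0) (b := 1) (C := C)
    (f := deriv f) (by filter_upwards [hC] with x hx _ using hx)
  simpa using this

/-- A function that is continuous in a real parameter for almost all points and almost everywhere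
measurable for every parameter is jointly measurable after removal of a null set. -/
theorem exists_null_measurable_uncurry {Ω : Type*} [MeasurableSpace Ω] {ν : Measure Ω}
    {f : ℝ → Ω → ℝ} (hm : ∀ θ, AEMeasurable (f θ) ν) {Q : Ω → Prop} (hQ : ∀ᵐ p ∂ν, Q p)
    (hc : ∀ p, Q p → Continuous fun θ => f θ p) :
    ∃ S : Set Ω, (∀ᵐ p ∂ν, p ∉ S) ∧ (∀ p ∉ S, Q p) ∧
      Measurable (Function.uncurry fun θ => Sᶜ.indicator (f θ)) := by
  have hall : ∀ᵐ p ∂ν, Q p ∧ ∀ k : ℚ, f k p = (hm k).mk (f k) p :=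
    hQ.and (ae_all_iff.2 fun k : ℚ => (hm k).ae_eq_mk)
  obtain ⟨S, hSsub, hSm, hS0⟩ := exists_measurable_superset_of_null (ae_iff.1 hall)
  have hgood : ∀ p ∉ S, Q p ∧ ∀ k : ℚ, f k p = (hm k).mk (f k) p := fun p hp => by
    by_contra h
    exact hp (hSsub h)
  refine ⟨S, measure_eq_zero_iff_ae_notMem.1 hS0, fun p hp => (hgood p hp).1, ?_⟩
  refine measurable_uncurry_of_continuous_of_measurable (fun p => ?_) fun θ => ?_
  · by_cases hp : p ∈ S
    · simp only [indicator_of_notMem (notMem_compl_iff.2 hp)]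
      exact continuous_const
    · simp only [indicator_of_mem (show p ∈ Sᶜ from hp)]
      exact hc p (hgood p hp).1
  · obtain ⟨x, hx⟩ : ∃ x : ℕ → ℚ, Tendsto (fun n => (x n : ℝ)) atTop (𝓝 θ) := by
      have h1 : θ ∈ closure (range ((↑) : ℚ → ℝ)) := Rat.denseRange_cast θ
      obtain ⟨y, hy, hlim⟩ := mem_closure_iff_seq_limit.1 h1
      choose x hx using hy
      exact ⟨x, by simpa only [hx] using hlim⟩
    refine measurable_of_tendsto_metrizable
      (f := fun n => Sᶜ.indicator ((hm (x n)).mk (f (x n))))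
      (fun n => (hm (x n)).measurable_mk.indicator hSm.compl) ?_
    rw [tendsto_pi_nhds]
    intro p
    by_cases hp : p ∈ S
    · simp only [indicator_of_notMem (notMem_compl_iff.2 hp)]
      exact tendsto_const_nhds
    · simp only [indicator_of_mem (show p ∈ Sᶜ from hp), ← (hgood p hp).2]
      exact ((hc p (hgood p hp).1).tendsto θ).comp hx

theorem measurable_deriv_of_differentiable {Ω : Type*} [MeasurableSpace Ω] {g : ℝ → Ω → ℝ}
    (hg : Measurable (Function.uncurry g)) (hd : ∀ p, Differentiable ℝ fun θ => g θ p) :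
    Measurable fun x : ℝ × Ω => deriv (fun θ => g θ x.2) x.1 := by
  refine measurable_of_tendsto_metrizable
    (f := fun (n : ℕ) (x : ℝ × Ω) => ((n : ℝ) + 1) * (g (x.1 + ((n : ℝ) + 1)⁻¹) x.2 - g x.1 x.2))
    (fun n => ?_) ?_
  · have h1 : Measurable fun x : ℝ × Ω => g (x.1 + ((n : ℝ) + 1)⁻¹) x.2 :=
      hg.comp ((measurable_fst.add_const _).prodMk measurable_snd)
    have h2 : Measurable fun x : ℝ × Ω => g x.1 x.2 := hg
    exact (h1.sub h2).const_mul _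
  · rw [tendsto_pi_nhds]
    intro x
    have h1 := (hd x.2 x.1).hasDerivAt.tendsto_slope_zero
    have h2 : Tendsto (fun n : ℕ => ((n : ℝ) + 1)⁻¹) atTop (𝓝[≠] 0) := by
      refine tendsto_nhdsWithin_iff.2 ⟨?_, Eventually.of_forall fun n => ?_⟩
      · simpa using tendsto_one_div_add_atTop_nhds_zero_nat (𝕜 := ℝ)
      · exact (show ((n : ℝ) + 1)⁻¹ ≠ 0 by positivity)
    simpa [Function.comp_def] using h1.comp h2

namespace DensityHyp

variable {L : ℕ} {ψ : EuclideanSpace ℝ (Fin L) → ℝ → ℝ → ℝ} {μ : ℝ → ℝ} {K : ℝ → ℝ → ℝ}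

/-- Joint measurability gives measurable sections only for almost every parameter. Such parameters
are dense, and continuity in the parameter passes measurability to the limit. -/
theorem aemeasurable_section (h : DensityHyp ψ μ K) (x : EuclideanSpace ℝ (Fin L)) :
    AEMeasurable (fun p : ℝ × ℝ => ψ x p.1 p.2) ((volume.restrict (Ioi (0 : ℝ))).prod volume) := by
  have h1 := h.measurable
  have hν : (volume : Measure (EuclideanSpace ℝ (Fin L) × ℝ × ℝ)).restrict
      (univ ×ˢ Ioi (0 : ℝ) ×ˢ univ) =
      (volume : Measure (EuclideanSpace ℝ (Fin L))).prod
        ((volume.restrict (Ioi (0 : ℝ))).prod volume) := by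
    rw [Measure.volume_eq_prod, ← Measure.prod_restrict, Measure.restrict_univ,
      volume_restrict_Ioi_prod_univ]
  rw [hν] at h1
  have h2 : ∀ᵐ y : EuclideanSpace ℝ (Fin L), AEMeasurable (fun p : ℝ × ℝ => ψ y p.1 p.2)
      ((volume.restrict (Ioi (0 : ℝ))).prod volume) := by
    filter_upwards [Measure.ae_ae_of_ae_prod h1.ae_eq_mk] with y hy
    exact ⟨_, h1.measurable_mk.comp measurable_prodMk_left, hy⟩
  have hx : x ∈ closure {y : EuclideanSpace ℝ (Fin L) |
      AEMeasurable (fun p : ℝ × ℝ => ψ y p.1 p.2)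
        ((volume.restrict (Ioi (0 : ℝ))).prod volume)} := Measure.dense_of_ae h2 x
  obtain ⟨y, hy, hlim⟩ := mem_closure_iff_seq_limit.1 hx
  refine aemeasurable_of_tendsto_metrizable_ae atTop hy ?_
  have hd := h.differentiable
  rw [volume_restrict_Ioi_prod_univ] at hd
  filter_upwards [hd] with p hp
  exact (hp.continuous.tendsto x).comp hlim

/-- The exceptional null set in the gradient bound depends on the parameter, so the mean value
inequality is not directly available. Along the segment from y to x, Fubini exchanges the
quantifiers: for almost every (r,v) the bound holds at almost every point of the segment, and
integrating the derivative suffices. -/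
theorem ae_abs_sub_le (h : DensityHyp ψ μ K) (x y : EuclideanSpace ℝ (Fin L)) :
    ∀ᵐ p : ℝ × ℝ ∂(volume.restrict (Ioi (0 : ℝ))).prod volume,
      |ψ x p.1 p.2 - ψ y p.1 p.2| ≤ K p.1 p.2 * ‖x - y‖ := by
  set ν := (volume.restrict (Ioi (0 : ℝ))).prod (volume : Measure ℝ) with hν
  have hd := h.differentiable
  have hK := h.integrable_K
  have hgrad := h.gradient_bound
  rw [IntegrableOn] at hK
  rw [volume_restrict_Ioi_prod_univ] at hd hK hgrad
  set γ : ℝ → EuclideanSpace ℝ (Fin L) := fun θ => y + θ • (x - y) with hγ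
  have hγd : ∀ θ, HasDerivAt γ (x - y) θ := fun θ => by
    simpa [hγ] using ((hasDerivAt_id θ).smul_const (x - y)).const_add y
  have hcomp : ∀ p : ℝ × ℝ, Differentiable ℝ (fun z => ψ z p.1 p.2) →
      ∀ θ, HasDerivAt (fun θ => ψ (γ θ) p.1 p.2)
        (fderiv ℝ (fun z => ψ z p.1 p.2) (γ θ) (x - y)) θ := fun p hp θ =>
    (hp (γ θ)).hasFDerivAt.comp_hasDerivAt θ (hγd θ)
  obtain ⟨S, hS, hgood, hGm⟩ := exists_null_measurable_uncurry (ν := ν)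
    (f := fun θ p => ψ (γ θ) p.1 p.2) (fun θ => h.aemeasurable_section (γ θ)) hd
    fun p hp => continuous_iff_continuousAt.2 fun θ => (hcomp p hp θ).continuousAt
  set G : ℝ → ℝ × ℝ → ℝ := fun θ => Sᶜ.indicator fun p => ψ (γ θ) p.1 p.2 with hG
  have hGψ : ∀ p, p ∉ S → (fun θ => G θ p) = fun θ => ψ (γ θ) p.1 p.2 := fun p hp => by
    ext θ
    exact indicator_of_mem (show p ∈ Sᶜ from hp) _
  have hGd : ∀ p, Differentiable ℝ fun θ => G θ p := fun p => by
    by_cases hp : p ∈ S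
    · have : (fun θ => G θ p) = fun _ => 0 := by
        ext θ; exact indicator_of_notMem (notMem_compl_iff.2 hp) _
      rw [this]
      exact differentiable_const _
    · rw [hGψ p hp]
      exact fun θ => (hcomp p (hgood p hp) θ).differentiableAt
  -- K is replaced by a measurable representative because the exchange of quantifiers needs a
  -- measurable set.
  have hbd : ∀ᵐ θ : ℝ, ∀ᵐ p ∂ν,
      |deriv (fun θ => G θ p) θ| ≤ hK.aestronglyMeasurable.mk _ p * ‖x - y‖ := by
    refine Eventually.of_forall fun θ => ?_
    filter_upwards [hS, hgrad (γ θ), hK.aestronglyMeasurable.ae_eq_mk] with p hp hp1 hp2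
    rw [hGψ p hp, (hcomp p (hgood p hp) θ).deriv, ← hp2, ← Real.norm_eq_abs]
    refine (ContinuousLinearMap.le_opNorm _ _).trans
      (mul_le_mul_of_nonneg_right ?_ (norm_nonneg _))
    rw [gradient, LinearIsometryEquiv.norm_map] at hp1
    exact hp1
  have hmeas : MeasurableSet {z : ℝ × ℝ × ℝ |
      |deriv (fun θ => G θ z.2) z.1| ≤ hK.aestronglyMeasurable.mk _ z.2 * ‖x - y‖} := by
    refine measurableSet_le ?_ ?_
    · exact (measurable_deriv_of_differentiable hGm hGd).abs
    · exact (hK.aestronglyMeasurable.stronglyMeasurable_mk.measurable.comp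
        measurable_snd).mul_const _
  have hswap := (Measure.ae_ae_comm hmeas).1 hbd
  filter_upwards [hswap, hS, hK.aestronglyMeasurable.ae_eq_mk] with p hp1 hp2 hp3
  have := abs_sub_le_of_ae_deriv_le (hGd p) hp1
  have e := fun θ => congrFun (hGψ p hp2) θ
  rw [e 1, e 0, ← hp3] at this
  simpa [hγ] using this

theorem ae_bounds (h : DensityHyp ψ μ K) (x : EuclideanSpace ℝ (Fin L)) :
    ∀ᵐ r ∂volume.restrict (Ioi (0 : ℝ)), AEStronglyMeasurable (ψ x r) volume ∧
      ∀ᵐ v, 0 ≤ ψ x r v ∧ ψ x r v ≤ μ r := by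
  have h1 := h.bounds x
  rw [volume_restrict_Ioi_prod_univ] at h1
  filter_upwards [Measure.ae_ae_of_ae_prod h1,
    (h.aemeasurable_section x).aestronglyMeasurable.prodMk_left] with r hr1 hr2
  exact ⟨hr2, hr1⟩

theorem ae_mu_nonneg (h : DensityHyp ψ μ K) : ∀ᵐ r ∂volume.restrict (Ioi (0 : ℝ)), 0 ≤ μ r := by
  filter_upwards [h.ae_bounds 0] with r hr
  obtain ⟨v, hv⟩ := hr.2.exists
  exact hv.1.trans hv.2

theorem ae_intervalIntegrable (h : DensityHyp ψ μ K) (x : EuclideanSpace ℝ (Fin L)) :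
    ∀ᵐ r ∂volume.restrict (Ioi (0 : ℝ)), ∀ a b, IntervalIntegrable (ψ x r) volume a b := by
  filter_upwards [h.ae_bounds x] with r hr a b
  rw [intervalIntegrable_iff]
  refine Measure.integrableOn_of_bounded (M := μ r) (by simp) hr.1 (ae_restrict_of_ae ?_)
  filter_upwards [hr.2] with v hv
  rw [Real.norm_eq_abs, abs_of_nonneg hv.1]
  exact hv.2

/-- The superposition kernel is nondecreasing in the state with slope at most `μ r`. -/
theorem ae_integral_sub (h : DensityHyp ψ μ K) (x : EuclideanSpace ℝ (Fin L)) :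
    ∀ᵐ r ∂volume.restrict (Ioi (0 : ℝ)), ∀ a b, a ≤ b →
      0 ≤ (∫ v in (0 : ℝ)..b, ψ x r v) - ∫ v in (0 : ℝ)..a, ψ x r v ∧
      (∫ v in (0 : ℝ)..b, ψ x r v) - (∫ v in (0 : ℝ)..a, ψ x r v) ≤ μ r * (b - a) := by
  filter_upwards [h.ae_bounds x, h.ae_intervalIntegrable x] with r hr hi a b hab
  rw [intervalIntegral.integral_interval_sub_left (hi _ _) (hi _ _)]
  constructor
  · refine intervalIntegral.integral_nonneg_of_ae hab ?_
    filter_upwards [hr.2] with v hv using hv.1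
  · have := intervalIntegral.integral_mono_ae hab (hi a b)
      (intervalIntegrable_const (c := μ r)) (by filter_upwards [hr.2] with v hv using hv.2)
    rwa [intervalIntegral.integral_const, smul_eq_mul, mul_comm] at this

theorem ae_abs_integral_sub_le (h : DensityHyp ψ μ K) (x : EuclideanSpace ℝ (Fin L)) :
    ∀ᵐ r ∂volume.restrict (Ioi (0 : ℝ)), ∀ a b,
      |(∫ v in (0 : ℝ)..b, ψ x r v) - ∫ v in (0 : ℝ)..a, ψ x r v| ≤ μ r * |b - a| := by
  filter_upwards [h.ae_integral_sub x] with r hr a b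
  rcases le_total a b with hab | hab
  · rw [abs_of_nonneg (hr a b hab).1, abs_of_nonneg (sub_nonneg.2 hab)]
    exact (hr a b hab).2
  · rw [abs_sub_comm, abs_sub_comm b, abs_of_nonneg (hr b a hab).1,
      abs_of_nonneg (sub_nonneg.2 hab)]
    exact (hr b a hab).2

theorem integrable_state (h : DensityHyp ψ μ K) (x : EuclideanSpace ℝ (Fin L)) {ζ : ℝ → ℝ}
    (hζ : Continuous ζ) {C : ℝ} (hC : ∀ r > 0, |ζ r| ≤ C) :
    Integrable (fun r => ∫ v in (0 : ℝ)..ζ r, ψ x r v) (volume.restrict (Ioi (0 : ℝ))) := by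
  have hm := (h.aemeasurable_section x).aestronglyMeasurable
  have hae : ∀ᵐ r ∂volume.restrict (Ioi (0 : ℝ)), r ∈ Ioi (0 : ℝ) :=
    ae_restrict_mem measurableSet_Ioi
  refine Integrable.mono' (g := fun r => μ r * C) (h.integrable_mu.mul_const C) ?_ ?_
  -- The oriented integral from 0 to ζ r is a difference of integrals over sections of two
  -- measurable planar sets.
  · have e : ∀ S : Set (ℝ × ℝ), MeasurableSet S → AEStronglyMeasurable
        (fun r => ∫ v in Prod.mk r ⁻¹' S, ψ x r v) (volume.restrict (Ioi (0 : ℝ))) := by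
      intro S hS
      have h1 := (hm.indicator hS).integral_prod_right'
      refine h1.congr (Eventually.of_forall fun r => ?_)
      beta_reduce
      rw [← integral_indicator (measurable_prodMk_left hS)]
      rfl
    have hp : MeasurableSet {p : ℝ × ℝ | 0 < p.2 ∧ p.2 ≤ ζ p.1} :=
      (measurableSet_lt measurable_const measurable_snd).inter
        (measurableSet_le measurable_snd (hζ.measurable.comp measurable_fst))
    have hn : MeasurableSet {p : ℝ × ℝ | ζ p.1 < p.2 ∧ p.2 ≤ 0} :=
      (measurableSet_lt (hζ.measurable.comp measurable_fst) measurable_snd).inter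
        (measurableSet_le measurable_snd measurable_const)
    exact (e _ hp).sub (e _ hn)
  · filter_upwards [h.ae_abs_integral_sub_le x, h.ae_mu_nonneg, hae] with r hr hμ hr0
    have := hr 0 (ζ r)
    rw [intervalIntegral.integral_same, sub_zero, sub_zero] at this
    exact this.trans (mul_le_mul_of_nonneg_left (hC r hr0) hμ)

theorem ae_K_nonneg (h : DensityHyp ψ μ K) :
    ∀ᵐ p : ℝ × ℝ ∂(volume.restrict (Ioi (0 : ℝ))).prod volume, 0 ≤ K p.1 p.2 := by
  have := h.gradient_bound 0
  rw [volume_restrict_Ioi_prod_univ] at this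
  filter_upwards [this] with p hp using (norm_nonneg _).trans hp

theorem mass_K_nonneg (h : DensityHyp ψ μ K) : 0 ≤ ∫ r in Ioi (0 : ℝ), ∫ v : ℝ, K r v := by
  refine integral_nonneg_of_ae ?_
  filter_upwards [Measure.ae_ae_of_ae_prod h.ae_K_nonneg] with r hr
  exact integral_nonneg_of_ae hr

/-- Lipschitz dependence of the Preisach functional on the parameter. -/
theorem abs_integral_state_sub_le (h : DensityHyp ψ μ K) (x y : EuclideanSpace ℝ (Fin L))
    {ζ : ℝ → ℝ} (hζ : Continuous ζ) {C : ℝ} (hC : ∀ r > 0, |ζ r| ≤ C) :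
    |(∫ r in Ioi (0 : ℝ), ∫ v in (0 : ℝ)..ζ r, ψ x r v) -
      ∫ r in Ioi (0 : ℝ), ∫ v in (0 : ℝ)..ζ r, ψ y r v| ≤
      (∫ r in Ioi (0 : ℝ), ∫ v : ℝ, K r v) * ‖x - y‖ := by
  have hK := h.integrable_K
  rw [IntegrableOn, volume_restrict_Ioi_prod_univ] at hK
  rw [← integral_sub (h.integrable_state x hζ hC) (h.integrable_state y hζ hC),
    ← integral_mul_const, ← Real.norm_eq_abs]
  refine norm_integral_le_of_norm_le (hK.integral_prod_left.mul_const _) ?_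
  filter_upwards [h.ae_intervalIntegrable x, h.ae_intervalIntegrable y,
    Measure.ae_ae_of_ae_prod h.ae_K_nonneg, Measure.ae_ae_of_ae_prod (h.ae_abs_sub_le x y),
    hK.prod_right_ae] with r hx hy hK0 hd hKi
  rw [← intervalIntegral.integral_sub (hx _ _) (hy _ _), ← integral_mul_const]
  refine intervalIntegral.norm_integral_le_integral_norm_uIoc.trans ?_
  refine (integral_mono_ae ((hx _ _).sub (hy _ _)).def'.norm
    (hKi.mul_const _).integrableOn (ae_restrict_of_ae hd)).trans ?_
  refine setIntegral_le_integral (hKi.mul_const _) ?_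
  filter_upwards [hK0] with v hv
  exact mul_nonneg hv (norm_nonneg _)

end DensityHyp

/-! ### Gronwall in the threshold and the stability estimate -/

section

section Tail

variable {μ : ℝ → ℝ}

theorem antitoneOn_tail (hμ : IntegrableOn μ (Ioi 0))
    (h0 : ∀ᵐ r ∂volume.restrict (Ioi (0 : ℝ)), 0 ≤ μ r) :
    AntitoneOn (fun x => ∫ s in Ioi x, μ s) (Ici 0) := fun _ hx _ _ hxy =>
  setIntegral_mono_set (hμ.mono_set (Ioi_subset_Ioi hx))
    (ae_restrict_of_ae_restrict_of_subset (Ioi_subset_Ioi hx) h0)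
    (Ioi_subset_Ioi hxy).eventuallyLE

theorem tail_nonneg (h0 : ∀ᵐ r ∂volume.restrict (Ioi (0 : ℝ)), 0 ≤ μ r) {x : ℝ} (hx : 0 ≤ x) :
    0 ≤ ∫ s in Ioi x, μ s :=
  integral_nonneg_of_ae (ae_restrict_of_ae_restrict_of_subset (Ioi_subset_Ioi hx) h0)

theorem integrableOn_mul_exp_tail (hμ : IntegrableOn μ (Ioi 0))
    (h0 : ∀ᵐ r ∂volume.restrict (Ioi (0 : ℝ)), 0 ≤ μ r) :
    IntegrableOn (fun s => μ s * Real.exp (∫ x in Ioi s, μ x)) (Ioi 0) := by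
  have hanti := antitoneOn_tail hμ h0
  refine Integrable.mono' (g := fun s => μ s * Real.exp (∫ x in Ioi 0, μ x))
    (hμ.mul_const _) ?_ ?_
  · refine hμ.aestronglyMeasurable.mul ?_
    exact (Real.measurable_exp.comp_aemeasurable (aemeasurable_restrict_of_antitoneOn
      measurableSet_Ioi (hanti.mono Ioi_subset_Ici_self))).aestronglyMeasurable
  · filter_upwards [h0, ae_restrict_mem measurableSet_Ioi] with s hs hs0
    rw [Real.norm_eq_abs, abs_of_nonneg (mul_nonneg hs (Real.exp_pos _).le)]
    exact mul_le_mul_of_nonneg_left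
      (Real.exp_le_exp.2 (hanti self_mem_Ici (mem_Ioi.1 hs0).le (mem_Ioi.1 hs0).le)) hs

/-- The integrand is almost everywhere the derivative of -exp(∫_x^∞ μ). For this monotone function
the integral of the derivative is at most the increment, so no absolute continuity is needed. -/
theorem setIntegral_mul_exp_tail_le (hμ : IntegrableOn μ (Ioi 0))
    (h0 : ∀ᵐ r ∂volume.restrict (Ioi (0 : ℝ)), 0 ≤ μ r) {r : ℝ} (hr : 0 ≤ r) :
    ∫ s in Ioi r, μ s * Real.exp (∫ x in Ioi s, μ x) ≤ Real.exp (∫ x in Ioi r, μ x) - 1 := by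
  have hanti := antitoneOn_tail hμ h0
  refine le_of_tendsto (intervalIntegral_tendsto_integral_Ioi r
    ((integrableOn_mul_exp_tail hμ h0).mono_set (Ioi_subset_Ioi hr)) tendsto_id) ?_
  filter_upwards [eventually_ge_atTop r] with R hR
  have hmono : MonotoneOn (fun x => -Real.exp (∫ s in Ioi x, μ s)) (uIcc r R) := by
    intro x hx y hy hxy
    rw [uIcc_of_le hR] at hx hy
    exact neg_le_neg (Real.exp_le_exp.2 (hanti (hr.trans hx.1) (hr.trans hy.1) hxy))
  have hmem := hmono.intervalIntegral_deriv_mem_uIcc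
  have hle : (fun x => -Real.exp (∫ s in Ioi x, μ s)) r ≤
      (fun x => -Real.exp (∫ s in Ioi x, μ s)) R := hmono left_mem_uIcc right_mem_uIcc hR
  rw [uIcc_of_le (sub_nonneg.2 hle)] at hmem
  have hRint : (1 : ℝ) ≤ Real.exp (∫ s in Ioi R, μ s) :=
    Real.one_le_exp (tail_nonneg h0 (hr.trans hR))
  have hint : IntervalIntegrable μ volume r R := by
    rw [intervalIntegrable_iff, uIoc_of_le hR]
    exact hμ.mono_set fun x hx => hr.trans_lt hx.1
  have hderiv : ∫ x in r..R, μ x * Real.exp (∫ s in Ioi x, μ s) =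
      ∫ x in r..R, deriv (fun x => -Real.exp (∫ s in Ioi x, μ s)) x := by
    refine intervalIntegral.integral_congr_ae ?_
    filter_upwards [hint.ae_hasDerivAt_integral] with x hx hxm
    rw [uIoc_of_le hR] at hxm
    have hx1 := hx (by rw [uIcc_of_le hR]; exact ⟨hxm.1.le, hxm.2⟩) r left_mem_uIcc
    have hloc : (fun y => ∫ s in Ioi y, μ s) =ᶠ[𝓝 x]
        fun y => (∫ s in Ioi r, μ s) - ∫ s in r..y, μ s := by
      filter_upwards [Ioi_mem_nhds hxm.1] with y hy
      have := intervalIntegral.integral_interval_add_Ioi (a := r) (b := y)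
        (hμ.mono_set (Ioi_subset_Ioi hr))
        (hμ.mono_set (Ioi_subset_Ioi (hr.trans (mem_Ioi.1 hy).le)))
      linarith
    have hd := ((hx1.const_sub (∫ s in Ioi r, μ s)).congr_of_eventuallyEq hloc).exp.fun_neg
    rw [hd.deriv]
    ring
  rw [id, hderiv]
  have := hmem.2
  linarith

end Tail

/-- The value of the Preisach operator at parameter `x` and memory state `ζ`. -/
def preisachState {L : ℕ} (ψ : EuclideanSpace ℝ (Fin L) → ℝ → ℝ → ℝ)
    (x : EuclideanSpace ℝ (Fin L)) (ζ : ℝ → ℝ) : ℝ :=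
  ∫ r in Ioi (0 : ℝ), ∫ v in (0 : ℝ)..ζ r, ψ x r v

variable {L : ℕ} {ψ : EuclideanSpace ℝ (Fin L) → ℝ → ℝ → ℝ} {μ : ℝ → ℝ} {K : ℝ → ℝ → ℝ}

theorem preisach_eq {T : ℝ} {u : ℝ → EuclideanSpace ℝ (Fin L)} {q : ℝ → ℝ}
    (hq : IsRightContRegulated T q) {t : ℝ} (ht : t ∈ Icc 0 T) :
    preisach ψ T u q t = preisachState ψ (u t) fun r => playFormula r q t := by
  refine setIntegral_congr_fun measurableSet_Ioi fun r hr => ?_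
  beta_reduce
  rw [play_eqOn_playFormula (ht.1.trans ht.2) hr hq ht]

theorem isLocalPlay_playFormula {T r : ℝ} {q : ℝ → ℝ} (hT : 0 ≤ T) (hr : 0 ≤ r)
    (hq : IsRightContRegulated T q) : IsLocalPlay T r q (playFormula r q) := by
  obtain ⟨C, hC⟩ := hq.1.exists_bound hT
  exact (isOrderPlay_playFormula hT hr hC).isLocalPlay hr hq

/-- One step of the comparison of two inputs through the difference of their residuals. -/
theorem DensityHyp.playFormula_sub_le (h : DensityHyp ψ μ K) {T lam ε C : ℝ}
    {u : ℝ → EuclideanSpace ℝ (Fin L)} {q₁ q₂ : ℝ → ℝ} (hlam : lam ∈ Icc (0 : ℝ) 1)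
    (hε : 0 ≤ ε) (hq₁ : IsRightContRegulated T q₁) (hq₂ : IsRightContRegulated T q₂)
    (hC₁ : ∀ t ∈ Icc 0 T, |q₁ t| ≤ C) (hC₂ : ∀ t ∈ Icc 0 T, |q₂ t| ≤ C)
    (hW : ∀ t ∈ Icc 0 T,
      (q₁ t + lam * preisachState ψ (u t) fun r => playFormula r q₁ t) -
        (q₂ t + lam * preisachState ψ (u t) fun r => playFormula r q₂ t) ≤ ε)
    {D : ℝ → ℝ} (hD0 : ∀ r > 0, 0 ≤ D r) (hDi : IntegrableOn (fun r => μ r * D r) (Ioi 0))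
    (hD : ∀ r > 0, ∀ t ∈ Icc 0 T, |playFormula r q₁ t - playFormula r q₂ t| ≤ D r)
    {r : ℝ} (hr : 0 < r) {t : ℝ} (ht : t ∈ Icc 0 T) :
    playFormula r q₁ t - playFormula r q₂ t ≤ ε + ∫ s in Ioi r, μ s * D s := by
  have hT := ht.1.trans ht.2
  have hμD : ∀ᵐ s ∂volume.restrict (Ioi (0 : ℝ)), 0 ≤ μ s * D s := by
    filter_upwards [h.ae_mu_nonneg, ae_restrict_mem measurableSet_Ioi] with s hs hs0
    exact mul_nonneg hs (hD0 s hs0)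
  have htail : 0 ≤ ∫ s in Ioi r, μ s * D s := tail_nonneg hμD hr.le
  refine (isLocalPlay_playFormula hT hr.le hq₁).sub_le (isLocalPlay_playFormula hT hr.le hq₂)
    (by positivity) (fun t ht hlt => ?_) t ht
  by_contra hcon
  have hC₁' : ∀ τ ∈ Icc 0 t, |q₁ τ| ≤ C := fun τ hτ => hC₁ τ ⟨hτ.1, hτ.2.trans ht.2⟩
  have hC₂' : ∀ τ ∈ Icc 0 t, |q₂ τ| ≤ C := fun τ hτ => hC₂ τ ⟨hτ.1, hτ.2.trans ht.2⟩
  have hp := fun (s : ℝ) (hs : 0 ≤ s) =>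
    abs_le.1 ((isLocalPlay_playFormula hT hs hq₁).abs_sub_le t ht)
  have hp' := fun (s : ℝ) (hs : 0 ≤ s) =>
    abs_le.1 ((isLocalPlay_playFormula hT hs hq₂).abs_sub_le t ht)
  have hl := fun s : ℝ => abs_le.1 (abs_playFormula_sub_le_threshold (r := r) ht.1 hC₁' s)
  have hl' := fun s : ℝ => abs_le.1 (abs_playFormula_sub_le_threshold (r := r) ht.1 hC₂' s)
  -- At a time where one of the two plays is pushed, all smaller thresholds are ordered.
  have hsmall : ∀ s, 0 ≤ s → s ≤ r →
      playFormula r q₁ t - playFormula r q₂ t ≤ playFormula s q₁ t - playFormula s q₂ t := by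
    intro s hs hsr
    have e1 := hl s
    have e2 := hl' s
    rw [abs_of_nonneg (sub_nonneg.2 hsr)] at e1 e2
    rw [not_and_or, not_lt, not_lt] at hcon
    rcases hcon with h' | h'
    · linarith [hp s hs]
    · linarith [hp' s hs]
  -- At threshold 0 the play is the input itself.
  have hq : playFormula r q₁ t - playFormula r q₂ t ≤ q₁ t - q₂ t := by
    have e0 := hp 0 le_rfl
    have e0' := hp' 0 le_rfl
    linarith [hsmall 0 le_rfl hr.le]
  have hi₁ := h.integrable_state (u t) (continuous_playFormula_threshold ht.1 hC₁')
    (C := C) fun s hs => abs_playFormula_le ht.1 hs.le hC₁'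
  have hi₂ := h.integrable_state (u t) (continuous_playFormula_threshold ht.1 hC₂')
    (C := C) fun s hs => abs_playFormula_le ht.1 hs.le hC₂'
  have hdiff : -∫ s in Ioi r, μ s * D s ≤
      (preisachState ψ (u t) fun r => playFormula r q₁ t) -
        preisachState ψ (u t) fun r => playFormula r q₂ t := by
    rw [preisachState, preisachState, ← integral_sub hi₁ hi₂, ← integral_neg]
    have e : ∫ s in Ioi r, -(μ s * D s) =
        ∫ s in Ioi (0 : ℝ), (Ioi r).indicator (fun s => -(μ s * D s)) s := by
      rw [setIntegral_indicator measurableSet_Ioi, Ioi_inter_Ioi, max_eq_right hr.le]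
    rw [e]
    refine integral_mono_ae (hDi.neg.indicator measurableSet_Ioi) (hi₁.sub hi₂) ?_
    filter_upwards [h.ae_abs_integral_sub_le (u t), h.ae_integral_sub (u t), h.ae_mu_nonneg,
      ae_restrict_mem measurableSet_Ioi] with s h1 h2 hμ hs
    have hs0 : 0 < s := hs
    rcases le_or_gt s r with hsr | hsr
    · rw [indicator_of_notMem (show s ∉ Ioi r from not_lt.2 hsr)]
      refine (h2 _ _ ?_).1
      linarith [hsmall s hs0.le hsr]
    · rw [indicator_of_mem (show s ∈ Ioi r from hsr)]
      have e1 := (abs_le.1 (h1 (playFormula s q₂ t) (playFormula s q₁ t))).1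
      have e2 := mul_le_mul_of_nonneg_left (hD s hs0 t ht) hμ
      linarith
  have h1 := hW t ht
  have h2 := mul_le_mul_of_nonneg_left hdiff hlam.1
  have h3 := mul_le_mul_of_nonneg_right hlam.2 htail
  linarith

/-- The inverse of `q ↦ q + λ P(u)[q]` is Lipschitz with constant `exp (∫ μ)`. -/
theorem DensityHyp.abs_sub_le_of_residual (h : DensityHyp ψ μ K) {T lam ε : ℝ}
    {u : ℝ → EuclideanSpace ℝ (Fin L)} {q₁ q₂ : ℝ → ℝ} (hlam : lam ∈ Icc (0 : ℝ) 1)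
    (hq₁ : IsRightContRegulated T q₁) (hq₂ : IsRightContRegulated T q₂)
    (hW : ∀ t ∈ Icc 0 T,
      |(q₁ t + lam * preisachState ψ (u t) fun r => playFormula r q₁ t) -
        (q₂ t + lam * preisachState ψ (u t) fun r => playFormula r q₂ t)| ≤ ε)
    {t : ℝ} (ht : t ∈ Icc 0 T) :
    |q₁ t - q₂ t| ≤ Real.exp (∫ r in Ioi (0 : ℝ), μ r) * ε := by
  have hT := ht.1.trans ht.2
  wlog hε : 0 < ε generalizing ε
  · have key : ∀ η > 0, |q₁ t - q₂ t| ≤ Real.exp (∫ r in Ioi (0 : ℝ), μ r) * η := fun η hη =>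
      this (fun s hs => (hW s hs).trans ((not_lt.1 hε).trans hη.le)) hη
    have hε0 : ε = 0 := le_antisymm (not_lt.1 hε) ((abs_nonneg _).trans (hW t ht))
    rw [hε0, mul_zero]
    refine le_of_forall_pos_le_add fun δ hδ => ?_
    have := key (δ / Real.exp (∫ r in Ioi (0 : ℝ), μ r)) (by positivity)
    rwa [mul_div_cancel₀ _ (Real.exp_pos _).ne', ← zero_add δ] at this
  obtain ⟨C₁, hC₁⟩ := hq₁.1.exists_bound hT
  obtain ⟨C₂, hC₂⟩ := hq₂.1.exists_bound hT
  have hμ0 := h.ae_mu_nonneg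
  set Φ : ℝ → ℝ := fun r => Real.exp (∫ s in Ioi r, μ s) with hΦ
  have hΦ1 : ∀ r, 0 < r → 1 ≤ Φ r := fun r hr => Real.one_le_exp (tail_nonneg hμ0 hr.le)
  have hΦM : ∀ r, 0 < r → Φ r ≤ Φ 0 := fun r hr => Real.exp_le_exp.2
    (antitoneOn_tail h.integrable_mu hμ0 self_mem_Ici hr.le hr.le)
  have hΦ0 : 1 ≤ Φ 0 := Real.one_le_exp (tail_nonneg hμ0 le_rfl)
  -- Gronwall's lemma by optimising the constant: the least k with |d_r| ≤ kε exp(∫_r^∞ μ) is shown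
  -- to be 1.
  set A : Set ℝ := {k | 1 ≤ k ∧ ∀ r > 0, ∀ t ∈ Icc 0 T,
    |playFormula r q₁ t - playFormula r q₂ t| ≤ k * (ε * Φ r)} with hA
  have hC₁' := fun s (hs : s ∈ Icc 0 T) => (hC₁ s hs).trans (le_max_left C₁ C₂)
  have hC₂' := fun s (hs : s ∈ Icc 0 T) => (hC₂ s hs).trans (le_max_right C₁ C₂)
  set C := max C₁ C₂
  have hC0 : 0 ≤ C := (abs_nonneg _).trans (hC₁' t ht)
  have hne : A.Nonempty := by
    refine ⟨2 * C / ε + 1, by simp; positivity, fun r hr s hs => ?_⟩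
    have e1 := abs_le.1 (abs_playFormula_le hs.1 hr.le fun τ hτ => hC₁' τ ⟨hτ.1, hτ.2.trans hs.2⟩)
    have e2 := abs_le.1 (abs_playFormula_le hs.1 hr.le fun τ hτ => hC₂' τ ⟨hτ.1, hτ.2.trans hs.2⟩)
    have e3 : |playFormula r q₁ s - playFormula r q₂ s| ≤ 2 * C := by
      rw [abs_le]; constructor <;> linarith
    refine e3.trans ?_
    have e4 : 2 * C ≤ (2 * C / ε + 1) * ε := by field_simp; linarith
    refine e4.trans (mul_le_mul_of_nonneg_left ?_ (by positivity))
    exact le_mul_of_one_le_right hε.le (hΦ1 r hr)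
  have hbdd : BddBelow A := ⟨1, fun k hk => hk.1⟩
  set k := sInf A with hk
  have hk1 : 1 ≤ k := le_csInf hne fun x hx => hx.1
  have hkA : ∀ r > 0, ∀ t ∈ Icc 0 T,
      |playFormula r q₁ t - playFormula r q₂ t| ≤ k * (ε * Φ r) := by
    intro r hr s hs
    have hpos : 0 < ε * Φ r := mul_pos hε (Real.exp_pos _)
    rw [← div_le_iff₀ hpos]
    exact le_csInf hne fun x hx => (div_le_iff₀ hpos).2 (hx.2 r hr s hs)
  have hDi : IntegrableOn (fun r => μ r * (k * (ε * Φ r))) (Ioi 0) := by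
    have := (integrableOn_mul_exp_tail h.integrable_mu hμ0).const_mul (k * ε)
    refine IntegrableOn.congr_fun this (fun r _ => ?_) measurableSet_Ioi
    simp only [hΦ]; ring
  have hD0 : ∀ r > 0, 0 ≤ k * (ε * Φ r) := fun r hr => by
    have := hΦ1 r hr
    positivity
  have hDint : ∀ r > 0, ∫ s in Ioi r, μ s * (k * (ε * Φ s)) ≤ k * ε * (Φ r - 1) := by
    intro r hr
    have := setIntegral_mul_exp_tail_le h.integrable_mu hμ0 hr.le
    have e : ∫ s in Ioi r, μ s * (k * (ε * Φ s)) = k * ε * ∫ s in Ioi r, μ s * Φ s := by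
      rw [← integral_const_mul]
      exact integral_congr_ae (Eventually.of_forall fun s => by ring)
    rw [e]
    exact mul_le_mul_of_nonneg_left this (by positivity)
  have himp : ∀ r > 0, ∀ t ∈ Icc 0 T,
      |playFormula r q₁ t - playFormula r q₂ t| ≤ k * (ε * Φ r) - (k - 1) * ε := by
    intro r hr s hs
    have e1 := h.playFormula_sub_le hlam hε.le hq₁ hq₂ hC₁' hC₂'
      (fun s hs => (abs_le.1 (hW s hs)).2) hD0 hDi hkA hr hs
    have e2 := h.playFormula_sub_le hlam hε.le hq₂ hq₁ hC₂' hC₁'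
      (fun s hs => by have := (abs_le.1 (hW s hs)).1; linarith) hD0 hDi
      (fun r hr s hs => by rw [abs_sub_comm]; exact hkA r hr s hs) hr hs
    have e3 := hDint r hr
    rw [abs_le]; constructor <;> linarith
  have hk_eq : k = 1 := by
    by_contra hk_ne
    have hk_gt : 1 < k := lt_of_le_of_ne hk1 (Ne.symm hk_ne)
    -- One comparison step improves the bound by (k - 1)ε uniformly in r; as Φ r ≤ Φ 0, this lowers
    -- k by (k - 1)/Φ 0.
    have hmem : k - (k - 1) / Φ 0 ∈ A := by
      refine ⟨?_, fun r hr s hs => (himp r hr s hs).trans ?_⟩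
      · have : (k - 1) / Φ 0 ≤ k - 1 := div_le_self (by linarith) hΦ0
        linarith
      · have : (k - 1) / Φ 0 * (ε * Φ r) ≤ (k - 1) * ε := by
          rw [div_mul_eq_mul_div, div_le_iff₀ (by positivity), mul_assoc]
          exact mul_le_mul_of_nonneg_left (mul_le_mul_of_nonneg_left (hΦM r hr) hε.le)
            (by linarith)
        linarith
    have h1 := csInf_le hbdd hmem
    have h2 : 0 < (k - 1) / Φ 0 := div_pos (by linarith) (by linarith)
    linarith
  -- Each input lies within δ/2 of its play with threshold δ/2.
  refine le_of_forall_pos_le_add fun δ hδ => ?_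
  have e1 := hkA (δ / 2) (half_pos hδ) t ht
  rw [hk_eq, one_mul] at e1
  have e2 := abs_le.1 ((isLocalPlay_playFormula hT (half_pos hδ).le hq₁).abs_sub_le t ht)
  have e3 := abs_le.1 ((isLocalPlay_playFormula hT (half_pos hδ).le hq₂).abs_sub_le t ht)
  have e4 := mul_le_mul_of_nonneg_left (hΦM _ (half_pos hδ)) hε.le
  have e5 : Real.exp (∫ r in Ioi (0 : ℝ), μ r) * ε = ε * Φ 0 := mul_comm _ _
  rw [abs_le] at e1 ⊢
  constructor <;> linarith [e1.1, e1.2]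

end

/-! ### Frozen inputs and regularity of solutions -/

theorem IsRightContRegulated.freeze {T : ℝ} {q : ℝ → ℝ} (hq : IsRightContRegulated T q) (s : ℝ) :
    IsRightContRegulated T (fun τ => q (min τ s)) := by
  have hlt : ∀ τ < s, (fun x => q (min x s)) =ᶠ[𝓝 τ] q := fun τ hτ => by
    filter_upwards [Iio_mem_nhds hτ] with x hx
    rw [min_eq_left (mem_Iio.1 hx).le]
  have hgt : ∀ τ, s < τ → (fun x => q (min x s)) =ᶠ[𝓝 τ] fun _ => q s := fun τ hτ => by
    filter_upwards [Ioi_mem_nhds hτ] with x hx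
    rw [min_eq_right (mem_Ioi.1 hx).le]
  have hright : ∀ τ ∈ Ico 0 T, ContinuousWithinAt (fun x => q (min x s)) (Ici τ) τ := by
    intro τ hτ
    rcases lt_or_ge τ s with h | h
    · exact (hq.2 τ hτ).congr_of_eventuallyEq ((hlt τ h).filter_mono nhdsWithin_le_nhds)
        (hlt τ h).eq_of_nhds
    · refine (continuousWithinAt_const (b := q s)).congr (fun x hx => ?_) ?_
      · rw [min_eq_right (h.trans hx)]
      · rw [min_eq_right h]
  refine ⟨⟨fun τ hτ => ⟨_, (hright τ hτ).mono Ioi_subset_Ici_self⟩, fun τ hτ => ?_⟩, hright⟩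
  rcases le_or_gt τ s with h | h
  · obtain ⟨l, hl⟩ := hq.1.2 τ hτ
    refine ⟨l, hl.congr' ?_⟩
    filter_upwards [self_mem_nhdsWithin] with x hx
    rw [min_eq_left ((mem_Iio.1 hx).le.trans h)]
  · exact ⟨q s, tendsto_const_nhds.congr' ((hgt τ h).symm.filter_mono nhdsWithin_le_nhds)⟩

theorem playFormula_freeze_of_le {r s τ : ℝ} {q : ℝ → ℝ} (h : τ ≤ s) :
    playFormula r (fun x => q (min x s)) τ = playFormula r q τ :=
  playFormula_congr fun x hx => by rw [min_eq_left (hx.2.trans h)]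

/-- A constant input neither pushes the play up nor down, so the whole memory state stays as it was
at time s. -/
theorem playFormula_freeze_of_ge {r s τ C : ℝ} {q : ℝ → ℝ} (hr : 0 ≤ r) (hs : 0 ≤ s)
    (hC : ∀ x ∈ Icc 0 s, |q x| ≤ C) (h : s ≤ τ) :
    playFormula r (fun x => q (min x s)) τ = playFormula r q s := by
  have ho := isOrderPlay_playFormula (hs.trans h) hr (q := fun x => q (min x s)) (C := C)
    fun x hx => hC _ ⟨le_min hx.1 hs, min_le_right _ _⟩
  have e := abs_le.1 (ho.abs_sub_le s ⟨hs, h⟩)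
  rw [← playFormula_freeze_of_le (q := q) (r := r) (le_refl s)]
  simp only [min_self] at e
  refine le_antisymm ((ho.le_max s τ (q s - r) hs h le_rfl fun x hx => ?_).trans
    (max_le le_rfl (by linarith)))
    ((le_min le_rfl (by linarith)).trans (ho.min_le s τ (q s + r) hs h le_rfl fun x hx => ?_))
  · rw [min_eq_right hx.1.le]
  · rw [min_eq_right hx.1.le]

theorem abs_playFormula_sub_le_of_osc {r s t C ε : ℝ} {q : ℝ → ℝ} (hr : 0 ≤ r) (hs : 0 ≤ s)
    (hst : s ≤ t) (hC : ∀ x ∈ Icc 0 t, |q x| ≤ C) (hε : ∀ τ ∈ Icc s t, |q τ - q s| ≤ ε) :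
    |playFormula r q t - playFormula r q s| ≤ ε := by
  rw [← playFormula_freeze_of_ge hr hs (fun x hx => hC x ⟨hx.1, hx.2.trans hst⟩) hst]
  refine abs_playFormula_sub_le (hs.trans hst) hC
    (fun x hx => hC _ ⟨le_min hx.1 hs, (min_le_left _ _).trans hx.2⟩) fun τ hτ => ?_
  rcases le_total τ s with h | h
  · rw [min_eq_left h, sub_self, abs_zero]
    exact (abs_nonneg _).trans (hε s ⟨le_rfl, hst⟩)
  · rw [min_eq_right h]
    exact hε τ ⟨h, hτ.2⟩

theorem preisachState_congr {L : ℕ} {ψ : EuclideanSpace ℝ (Fin L) → ℝ → ℝ → ℝ}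
    {x : EuclideanSpace ℝ (Fin L)} {ζ ζ' : ℝ → ℝ} (h : ∀ r > 0, ζ r = ζ' r) :
    preisachState ψ x ζ = preisachState ψ x ζ' :=
  setIntegral_congr_fun measurableSet_Ioi fun r hr => by rw [h r hr]

namespace DensityHyp

variable {L : ℕ} {ψ : EuclideanSpace ℝ (Fin L) → ℝ → ℝ → ℝ} {μ : ℝ → ℝ} {K : ℝ → ℝ → ℝ}

theorem abs_preisachState_sub_le (h : DensityHyp ψ μ K) (x : EuclideanSpace ℝ (Fin L))
    {ζ ζ' : ℝ → ℝ} (hζ : Continuous ζ) (hζ' : Continuous ζ') {C D : ℝ}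
    (hC : ∀ r > 0, |ζ r| ≤ C) (hC' : ∀ r > 0, |ζ' r| ≤ C) (hD : ∀ r > 0, |ζ r - ζ' r| ≤ D) :
    |preisachState ψ x ζ - preisachState ψ x ζ'| ≤ (∫ r in Ioi (0 : ℝ), μ r) * D := by
  rw [preisachState, preisachState,
    ← integral_sub (h.integrable_state x hζ hC) (h.integrable_state x hζ' hC'),
    ← integral_mul_const, ← Real.norm_eq_abs]
  refine norm_integral_le_of_norm_le (h.integrable_mu.mul_const D) ?_
  filter_upwards [h.ae_abs_integral_sub_le x, h.ae_mu_nonneg, ae_restrict_mem measurableSet_Ioi]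
    with r h1 h2 hr
  exact (h1 _ _).trans (mul_le_mul_of_nonneg_left (hD r hr) h2)

/-- Increments of a solution are controlled by increments of the data. -/
theorem abs_increment_le (h : DensityHyp ψ μ K) {T : ℝ} {u : ℝ → EuclideanSpace ℝ (Fin L)}
    {w q : ℝ → ℝ} (hq : IsSolution ψ T u w q) {s t ρ : ℝ} (hs : 0 ≤ s) (hst : s ≤ t) (ht : t ≤ T)
    (hρ : ∀ τ ∈ Icc s t,
      |w τ - w s| + (∫ r in Ioi (0 : ℝ), ∫ v : ℝ, K r v) * ‖u τ - u s‖ ≤ ρ) :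
    |q t - q s| ≤ Real.exp (∫ r in Ioi (0 : ℝ), μ r) * ρ := by
  have hqt := hq.1.mono ht
  have ht0 := hs.trans hst
  obtain ⟨C, hC⟩ := hqt.1.exists_bound ht0
  have hCs : ∀ x ∈ Icc 0 s, |q x| ≤ C := fun x hx => hC x ⟨hx.1, hx.2.trans hst⟩
  -- q is compared with itself frozen at s. After s the frozen residual is q s plus the Preisach
  -- value of the state at s with parameter u τ; the equation at s turns the mismatch into w τ - w s
  -- and a change of parameter in one fixed state.
  have key := h.abs_sub_le_of_residual (lam := 1) (u := u) (ε := ρ) ⟨zero_le_one, le_rfl⟩ hqt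
    (hqt.freeze s) (fun τ hτ => ?_) (t := t) ⟨ht0, le_rfl⟩
  · simpa [min_eq_right hst] using key
  have hρ0 : 0 ≤ ρ := by
    have := hρ s ⟨le_rfl, hst⟩
    simpa using this
  simp only [one_mul]
  rcases le_total τ s with hτs | hτs
  · rw [preisachState_congr (fun r _ => playFormula_freeze_of_le (r := r) (q := q) hτs),
      min_eq_left hτs, sub_self, abs_zero]
    exact hρ0
  · rw [preisachState_congr (ζ := fun r => playFormula r (fun x => q (min x s)) τ)
      (fun r hr => playFormula_freeze_of_ge (le_of_lt hr) hs hCs hτs), min_eq_right hτs]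
    have e1 := hq.2 τ ⟨hτ.1, hτ.2.trans ht⟩
    have e2 := hq.2 s ⟨hs, hst.trans ht⟩
    rw [preisach_eq hq.1 ⟨hτ.1, hτ.2.trans ht⟩] at e1
    rw [preisach_eq hq.1 ⟨hs, hst.trans ht⟩] at e2
    have e3 := h.abs_integral_state_sub_le (u τ) (u s)
      (continuous_playFormula_threshold hs hCs) (C := C)
      fun r hr => abs_playFormula_le hs hr.le hCs
    have e4 := hρ τ ⟨hτs, hτ.2⟩
    change |preisachState ψ (u τ) (fun r => playFormula r q s) -
      preisachState ψ (u s) (fun r => playFormula r q s)| ≤ _ at e3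
    have e5 := le_abs_self (w τ - w s)
    have e6 := neg_abs_le (w τ - w s)
    rw [abs_le] at e3 ⊢
    constructor <;> linarith [e3.1, e3.2]

theorem continuousOn_of_isSolution (h : DensityHyp ψ μ K) {T : ℝ}
    {u : ℝ → EuclideanSpace ℝ (Fin L)} {w q : ℝ → ℝ} (hu : ContinuousOn u (Icc 0 T))
    (hw : ContinuousOn w (Icc 0 T)) (hq : IsSolution ψ T u w q) : ContinuousOn q (Icc 0 T) := by
  set M := ∫ r in Ioi (0 : ℝ), μ r
  set M₁ := ∫ r in Ioi (0 : ℝ), ∫ v : ℝ, K r v with hM₁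
  have hM₁0 : 0 ≤ M₁ := h.mass_K_nonneg
  have hu' := Metric.uniformContinuousOn_iff.1 (isCompact_Icc.uniformContinuousOn_of_continuous hu)
  have hw' := Metric.uniformContinuousOn_iff.1 (isCompact_Icc.uniformContinuousOn_of_continuous hw)
  rw [Metric.continuousOn_iff]
  intro b hb ε hε
  obtain ⟨η, hη, hη'⟩ : ∃ η > 0, Real.exp M * (η + M₁ * η) < ε := by
    refine ⟨ε / (2 * (Real.exp M * (1 + M₁))), by positivity, ?_⟩
    have e : Real.exp M * (ε / (2 * (Real.exp M * (1 + M₁))) +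
        M₁ * (ε / (2 * (Real.exp M * (1 + M₁))))) = ε / 2 := by
      field_simp
    rw [e]
    linarith
  obtain ⟨δ₁, hδ₁, hu'⟩ := hu' η hη
  obtain ⟨δ₂, hδ₂, hw'⟩ := hw' η hη
  have key : ∀ s ∈ Icc 0 T, ∀ t ∈ Icc 0 T, s ≤ t → dist s t < min δ₁ δ₂ → |q t - q s| < ε := by
    intro s hs t ht hst hd
    refine (h.abs_increment_le hq hs.1 hst ht.2 fun τ hτ => ?_).trans_lt hη'
    have hτT : τ ∈ Icc 0 T := ⟨hs.1.trans hτ.1, hτ.2.trans ht.2⟩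
    have hdτ : dist τ s < min δ₁ δ₂ := by
      rw [dist_comm]
      refine lt_of_le_of_lt ?_ hd
      rw [Real.dist_eq, Real.dist_eq, abs_sub_comm, abs_sub_comm s,
        abs_of_nonneg (by linarith [hτ.1]), abs_of_nonneg (by linarith)]
      linarith [hτ.2]
    have e1 := (hu' τ hτT s hs (hdτ.trans_le (min_le_left _ _))).le
    have e2 := (hw' τ hτT s hs (hdτ.trans_le (min_le_right _ _))).le
    rw [dist_eq_norm] at e1
    rw [Real.dist_eq] at e2
    exact add_le_add e2 (mul_le_mul_of_nonneg_left e1 hM₁0)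
  refine ⟨min δ₁ δ₂, lt_min hδ₁ hδ₂, fun a ha hab => ?_⟩
  rw [Real.dist_eq]
  rcases le_total a b with hle | hle
  · rw [abs_sub_comm]; exact key a ha b hb hle hab
  · exact key b hb a ha hle (by rwa [dist_comm])

theorem absolutelyContinuous_of_isSolution (h : DensityHyp ψ μ K) {T : ℝ} (hT : 0 ≤ T)
    {u : ℝ → EuclideanSpace ℝ (Fin L)} {w q : ℝ → ℝ}
    (hu : AbsolutelyContinuousOnInterval u 0 T) (hw : AbsolutelyContinuousOnInterval w 0 T)
    (hq : IsSolution ψ T u w q) : AbsolutelyContinuousOnInterval q 0 T := by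
  set M := ∫ r in Ioi (0 : ℝ), μ r
  set M₁ := ∫ r in Ioi (0 : ℝ), ∫ v : ℝ, K r v with hM₁
  have hM₁0 : 0 ≤ M₁ := h.mass_K_nonneg
  have huc := hu.continuousOn
  have hwc := hw.continuousOn
  -- The increment of q over an interval is bounded by the data increment to a maximising time τ
  -- inside it. Shrinking each interval to end at τ keeps a family disjoint and does not increase
  -- its total length.
  have hmax : ∀ a ∈ uIcc 0 T, ∀ b ∈ uIcc 0 T, ∃ τ ∈ Icc (min a b) (max a b),
      dist (q a) (q b) ≤ Real.exp M * (dist (w (min a b)) (w τ) +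
        M₁ * dist (u (min a b)) (u τ)) := by
    intro a ha b hb
    rw [uIcc_of_le hT] at ha hb huc hwc
    set s := min a b with hs
    set t := max a b with ht
    have hs0 : 0 ≤ s := le_min ha.1 hb.1
    have htT : t ≤ T := max_le ha.2 hb.2
    have hst : s ≤ t := min_le_max
    have hsub : Icc s t ⊆ Icc 0 T := Icc_subset_Icc hs0 htT
    have hcont : ContinuousOn (fun τ => |w τ - w s| + M₁ * ‖u τ - u s‖) (Icc s t) :=
      ((hwc.mono hsub).sub continuousOn_const).abs.add
        (continuousOn_const.mul ((huc.mono hsub).sub continuousOn_const).norm)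
    obtain ⟨τ, hτ, hτmax⟩ := isCompact_Icc.exists_isMaxOn ⟨s, le_rfl, hst⟩ hcont
    refine ⟨τ, hτ, ?_⟩
    have := h.abs_increment_le hq hs0 hst htT (fun x hx => hτmax hx)
    rw [Real.dist_eq, dist_comm (u s), dist_comm (w s), Real.dist_eq, dist_eq_norm]
    refine le_trans (le_of_eq ?_) this
    rcases le_total a b with hab | hab
    · rw [hs, ht, min_eq_left hab, max_eq_right hab, abs_sub_comm]
    · rw [hs, ht, min_eq_right hab, max_eq_left hab]
  choose! σ hσ hσq using hmax
  rw [absolutelyContinuousOnInterval_iff] at hu hw ⊢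
  intro ε hε
  -- M₁ + 1 replaces M₁, which may vanish, in the denominator.
  obtain ⟨δ₁, hδ₁, hu⟩ := hu (ε / (2 * (Real.exp M * (M₁ + 1)))) (by positivity)
  obtain ⟨δ₂, hδ₂, hw⟩ := hw (ε / (2 * Real.exp M)) (by positivity)
  refine ⟨min δ₁ δ₂, lt_min hδ₁ hδ₂, fun E hE hlen => ?_⟩
  set E' : ℕ × (ℕ → ℝ × ℝ) := (E.1, fun i => (min (E.2 i).1 (E.2 i).2, σ (E.2 i).1 (E.2 i).2))
    with hE'
  have hσ' : ∀ i ∈ Finset.range E.1, σ (E.2 i).1 (E.2 i).2 ∈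
      Icc (min (E.2 i).1 (E.2 i).2) (max (E.2 i).1 (E.2 i).2) := fun i hi =>
    hσ _ (hE.1 i hi).1 _ (hE.1 i hi).2
  have hE'mem : E' ∈ AbsolutelyContinuousOnInterval.disjWithin 0 T := by
    refine ⟨fun i hi => ?_, fun i hi j hj hij => ?_⟩
    · have hsub : Icc (min (E.2 i).1 (E.2 i).2) (max (E.2 i).1 (E.2 i).2) ⊆ uIcc 0 T :=
        uIcc_subset_uIcc (hE.1 i hi).1 (hE.1 i hi).2
      exact ⟨hsub ⟨le_rfl, min_le_max⟩, hsub (hσ' i hi)⟩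
    · have hsub : ∀ i ∈ Finset.range E.1, uIoc (E'.2 i).1 (E'.2 i).2 ⊆
          uIoc (E.2 i).1 (E.2 i).2 := fun i hi => by
        rw [uIoc_of_le (hσ' i hi).1]
        exact Ioc_subset_Ioc_right (hσ' i hi).2
      exact (hE.2 hi hj hij).mono (hsub i hi) (hsub j hj)
  have hlen' : ∑ i ∈ Finset.range E'.1, dist (E'.2 i).1 (E'.2 i).2 < min δ₁ δ₂ := by
    refine lt_of_le_of_lt (Finset.sum_le_sum fun i hi => ?_) hlen
    have := hσ' i hi
    rw [Real.dist_eq, Real.dist_eq, abs_sub_comm, abs_of_nonneg (sub_nonneg.2 this.1),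
      ← max_sub_min_eq_abs']
    exact sub_le_sub_right this.2 _
  have hu1 := hu E' hE'mem (hlen'.trans_le (min_le_left _ _))
  have hw1 := hw E' hE'mem (hlen'.trans_le (min_le_right _ _))
  calc ∑ i ∈ Finset.range E.1, dist (q (E.2 i).1) (q (E.2 i).2)
      ≤ ∑ i ∈ Finset.range E.1, Real.exp M * (dist (w (E'.2 i).1) (w (E'.2 i).2) +
        M₁ * dist (u (E'.2 i).1) (u (E'.2 i).2)) :=
        Finset.sum_le_sum fun i hi => hσq _ (hE.1 i hi).1 _ (hE.1 i hi).2
    _ = Real.exp M * (∑ i ∈ Finset.range E'.1, dist (w (E'.2 i).1) (w (E'.2 i).2)) +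
        Real.exp M * M₁ * ∑ i ∈ Finset.range E'.1, dist (u (E'.2 i).1) (u (E'.2 i).2) := by
        rw [← Finset.mul_sum, Finset.sum_add_distrib, ← Finset.mul_sum]; ring
    _ < Real.exp M * (ε / (2 * Real.exp M)) +
        Real.exp M * (M₁ + 1) * (ε / (2 * (Real.exp M * (M₁ + 1)))) := by
        refine add_lt_add_of_lt_of_le (mul_lt_mul_of_pos_left hw1 (Real.exp_pos _)) ?_
        have hnn : 0 ≤ ∑ i ∈ Finset.range E'.1, dist (u (E'.2 i).1) (u (E'.2 i).2) :=
          Finset.sum_nonneg fun i _ => dist_nonneg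
        have hexp := Real.exp_pos M
        exact mul_le_mul (mul_le_mul_of_nonneg_left (by linarith) hexp.le) hu1.le hnn
          (by positivity)
    _ = ε := by field_simp; ring

theorem abs_deriv_le_of_isSolution (h : DensityHyp ψ μ K) {T : ℝ}
    {u : ℝ → EuclideanSpace ℝ (Fin L)} {w q : ℝ → ℝ} (hq : IsSolution ψ T u w q) {t : ℝ}
    (ht : t ∈ Ico 0 T) (hqd : DifferentiableAt ℝ q t) (hwd : DifferentiableAt ℝ w t)
    (hud : DifferentiableAt ℝ u t) :
    |deriv q t| ≤ Real.exp (∫ r in Ioi (0 : ℝ), μ r) *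
      (|deriv w t| + (∫ r in Ioi (0 : ℝ), ∫ v : ℝ, K r v) * ‖deriv u t‖) := by
  set M := ∫ r in Ioi (0 : ℝ), μ r
  set M₁ := ∫ r in Ioi (0 : ℝ), ∫ v : ℝ, K r v with hM₁
  have hM₁0 : 0 ≤ M₁ := h.mass_K_nonneg
  have bound : ∀ {F : Type} [NormedAddCommGroup F] [NormedSpace ℝ F] {f : ℝ → F},
      DifferentiableAt ℝ f t → ∀ η > 0, ∀ᶠ x in 𝓝 t, ‖f x - f t‖ ≤ (‖deriv f t‖ + η) * |x - t| := by
    intro F _ _ f hf η hη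
    filter_upwards [(hasDerivAt_iff_isLittleO.1 hf.hasDerivAt).def hη] with x hx
    have e1 := norm_sub_norm_le (f x - f t) ((x - t) • deriv f t)
    rw [norm_smul, Real.norm_eq_abs] at e1
    rw [Real.norm_eq_abs] at hx
    linarith
  have hη : ∀ η > 0, |deriv q t| ≤ Real.exp M * ((|deriv w t| + η) + M₁ * (‖deriv u t‖ + η)) := by
    intro η hη
    -- Right difference quotients suffice, and the increment estimate bounds them, which is why t =
    -- T is excluded.
    have hslope := (hasDerivAt_iff_tendsto_slope.1 hqd.hasDerivAt).mono_left
      (nhdsWithin_mono t (show Ioi t ⊆ {t}ᶜ from fun x hx => (mem_Ioi.1 hx).ne'))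
    refine le_of_tendsto hslope.abs ?_
    obtain ⟨d, hd, hd'⟩ := (mem_nhdsGE_iff_exists_Ico_subset).1
      (((bound hwd η hη).and (bound hud η hη)).filter_mono (nhdsWithin_le_nhds (s := Ici t)))
    filter_upwards [Ioo_mem_nhdsGT (show t < min d T from lt_min hd ht.2)] with x hx
    have hx2 := lt_min_iff.1 hx.2
    have hxt : 0 < x - t := sub_pos.2 hx.1
    rw [slope_def_field, abs_div, abs_of_pos hxt, div_le_iff₀ hxt, mul_assoc]
    refine h.abs_increment_le hq ht.1 hx.1.le hx2.2.le fun τ hτ => ?_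
    obtain ⟨e1, e2⟩ := hd' ⟨hτ.1, hτ.2.trans_lt hx2.1⟩
    rw [abs_of_nonneg (sub_nonneg.2 hτ.1)] at e1 e2
    rw [Real.norm_eq_abs, Real.norm_eq_abs] at e1
    have e3 : τ - t ≤ x - t := sub_le_sub_right hτ.2 t
    have e4 := mul_le_mul_of_nonneg_left e3 (show 0 ≤ |deriv w t| + η by positivity)
    have e5 := mul_le_mul_of_nonneg_left e3 (show 0 ≤ ‖deriv u t‖ + η by positivity)
    have e6 := mul_le_mul_of_nonneg_left (e2.trans e5) hM₁0
    linarith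
  refine ge_of_tendsto (x := 𝓝[>] (0 : ℝ)) (f := fun η =>
    Real.exp M * ((|deriv w t| + η) + M₁ * (‖deriv u t‖ + η))) ?_
    (by filter_upwards [self_mem_nhdsWithin] with η hη' using hη η hη')
  have hc : Continuous fun η : ℝ =>
      Real.exp M * ((|deriv w t| + η) + M₁ * (‖deriv u t‖ + η)) := by fun_prop
  have := (hc.tendsto 0).mono_left (nhdsWithin_le_nhds (s := Ioi 0))
  simpa using this

end DensityHyp

/-! ### Existence by continuation -/

/-- The continuity method for `x ↦ x + P x` with Lipschitz `P`, under an a priori estimate. -/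
theorem exists_add_eq_of_lipschitz {X : Type*} [NormedAddCommGroup X] [NormedSpace ℝ X]
    [CompleteSpace X] {P : X → X} {M C : ℝ} (hC : 0 ≤ C)
    (hP : ∀ x y, ‖P x - P y‖ ≤ M * ‖x - y‖)
    (hPC : ∀ lam ∈ Icc (0 : ℝ) 1, ∀ x y,
      ‖x - y‖ ≤ C * ‖(x + lam • P x) - (y + lam • P y)‖) (w : X) : ∃ x, x + P x = w := by
  -- The parameter advances by 1/n. With n > C max(M,0), the map x ↦ R(w - P x / n), where R inverts
  -- id + (k/n)P, is a contraction: the a priori estimate makes R C-Lipschitz at every stage.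
  obtain ⟨n, hn⟩ := exists_nat_gt (max (C * max M 0) 0)
  have hn0 : (0 : ℝ) < n := (le_max_right _ _).trans_lt hn
  have hnC : C * max M 0 < n := (le_max_left _ _).trans_lt hn
  have key : ∀ k : ℕ, k ≤ n → ∀ w, ∃ x, x + ((k : ℝ) / n) • P x = w := by
    intro k
    induction k with
    | zero => intro _ w; exact ⟨w, by simp⟩
    | succ k ih =>
      intro hk w
      choose R hR using ih (by omega)
      have hkn : ((k : ℝ) / n) ∈ Icc (0 : ℝ) 1 :=
        ⟨by positivity, (div_le_one hn0).2 (by exact_mod_cast (show k ≤ n by omega))⟩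
      have hcontr : ContractingWith (Real.toNNReal (C * max M 0 / n))
          fun x => R (w - (1 / (n : ℝ)) • P x) := by
        refine ⟨?_, LipschitzWith.of_dist_le_mul fun x y => ?_⟩
        · rw [Real.toNNReal_lt_one, div_lt_one hn0]
          exact hnC
        · rw [Real.coe_toNNReal _ (by positivity), dist_eq_norm, dist_eq_norm]
          refine (hPC _ hkn _ _).trans ?_
          rw [hR, hR, sub_sub_sub_cancel_left, ← smul_sub, norm_smul, norm_sub_rev,
            Real.norm_of_nonneg (by positivity)]
          have e1 := (hP x y).trans (mul_le_mul_of_nonneg_right (le_max_left M 0) (norm_nonneg _))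
          calc C * (1 / n * ‖P x - P y‖) = C / n * ‖P x - P y‖ := by ring
            _ ≤ C / n * (max M 0 * ‖x - y‖) := mul_le_mul_of_nonneg_left e1 (by positivity)
            _ = C * max M 0 / n * ‖x - y‖ := by ring
      refine ⟨hcontr.fixedPoint _, ?_⟩
      have hfix : R (w - (1 / (n : ℝ)) • P (hcontr.fixedPoint _)) = hcontr.fixedPoint _ :=
        hcontr.fixedPoint_isFixedPt
      have := hR (w - (1 / (n : ℝ)) • P (hcontr.fixedPoint _))
      rw [hfix] at this
      rw [Nat.cast_succ, add_div, add_smul, ← add_assoc, this, sub_add_cancel]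
  obtain ⟨x, hx⟩ := key n le_rfl w
  exact ⟨x, by rwa [div_self hn0.ne', one_smul] at hx⟩

theorem isRightContRegulated_of_continuous {T : ℝ} {q : ℝ → ℝ} (hq : Continuous q) :
    IsRightContRegulated T q :=
  ⟨⟨fun t _ => ⟨q t, hq.continuousWithinAt⟩, fun t _ => ⟨q t, hq.continuousWithinAt⟩⟩,
    fun _ _ => hq.continuousWithinAt⟩

namespace DensityHyp

variable {L : ℕ} {ψ : EuclideanSpace ℝ (Fin L) → ℝ → ℝ → ℝ} {μ : ℝ → ℝ} {K : ℝ → ℝ → ℝ}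

/-- Needed for the Preisach operator to map C[0,T] to itself. The change of parameter is controlled
by K, and the change of memory state by μ and the oscillation of q, uniformly in the threshold. -/
theorem continuousOn_preisachState (h : DensityHyp ψ μ K) {T : ℝ} (hT : 0 ≤ T)
    {u : ℝ → EuclideanSpace ℝ (Fin L)} (hu : ContinuousOn u (Icc 0 T)) {q : ℝ → ℝ}
    (hq : Continuous q) :
    ContinuousOn (fun t => preisachState ψ (u t) fun r => playFormula r q t) (Icc 0 T) := by
  obtain ⟨C, hC⟩ := (isRightContRegulated_of_continuous (T := T) hq).1.exists_bound hT
  have hC' : ∀ t ∈ Icc 0 T, ∀ x ∈ Icc 0 t, |q x| ≤ C := fun t ht x hx =>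
    hC x ⟨hx.1, hx.2.trans ht.2⟩
  set M := ∫ r in Ioi (0 : ℝ), μ r
  set M₁ := ∫ r in Ioi (0 : ℝ), ∫ v : ℝ, K r v with hM₁
  have hM0 : 0 ≤ M := tail_nonneg h.ae_mu_nonneg le_rfl
  have hM₁0 : 0 ≤ M₁ := h.mass_K_nonneg
  have hquc := Metric.uniformContinuousOn_iff.1
    (isCompact_Icc.uniformContinuousOn_of_continuous (hq.continuousOn (s := Icc 0 T)))
  rw [Metric.continuousOn_iff]
  intro b hb ε hε
  obtain ⟨η, hη, hη'⟩ : ∃ η > 0, M₁ * η + M * η < ε := by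
    refine ⟨ε / (2 * (M₁ + M + 1)), by positivity, ?_⟩
    rw [← add_mul, mul_div_assoc', div_lt_iff₀ (by positivity)]
    nlinarith
  obtain ⟨δ₁, hδ₁, hu'⟩ := Metric.continuousOn_iff.1 hu b hb η hη
  obtain ⟨δ₂, hδ₂, hq'⟩ := hquc η hη
  have hplay : ∀ s ∈ Icc 0 T, ∀ t ∈ Icc 0 T, s ≤ t → dist t s < δ₂ → ∀ r > 0,
      |playFormula r q t - playFormula r q s| ≤ η := by
    intro s hs t ht hst hd r hr
    refine abs_playFormula_sub_le_of_osc hr.le hs.1 hst (hC' t ht) fun τ hτ => ?_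
    rw [← Real.dist_eq]
    refine (hq' τ ⟨hs.1.trans hτ.1, hτ.2.trans ht.2⟩ s hs (lt_of_le_of_lt ?_ hd)).le
    rw [Real.dist_eq, Real.dist_eq, abs_of_nonneg (sub_nonneg.2 hτ.1),
      abs_of_nonneg (sub_nonneg.2 hst)]
    exact sub_le_sub_right hτ.2 s
  have hcont := fun t (ht : t ∈ Icc 0 T) => continuous_playFormula_threshold ht.1 (hC' t ht)
  have hbd := fun t (ht : t ∈ Icc 0 T) (r : ℝ) (hr : r > 0) =>
    abs_playFormula_le ht.1 hr.le (hC' t ht)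
  refine ⟨min δ₁ δ₂, lt_min hδ₁ hδ₂, fun a ha hab => ?_⟩
  have e1 := h.abs_integral_state_sub_le (u a) (u b) (hcont a ha) (hbd a ha)
  have e2 := h.abs_preisachState_sub_le (u b) (hcont a ha) (hcont b hb) (hbd a ha) (hbd b hb)
    (D := η) fun r hr => by
      have hab2 := hab.trans_le (min_le_right δ₁ δ₂)
      rcases le_total b a with hle | hle
      · exact hplay b hb a ha hle hab2 r hr
      · rw [abs_sub_comm]
        exact hplay a ha b hb hle (by rwa [dist_comm]) r hr
  have e3 := (hu' a ha (hab.trans_le (min_le_left δ₁ δ₂))).le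
  rw [dist_eq_norm] at e3
  have e4 := mul_le_mul_of_nonneg_left e3 hM₁0
  change |preisachState ψ (u a) (fun r => playFormula r q a) -
    preisachState ψ (u b) (fun r => playFormula r q a)| ≤ _ at e1
  rw [Real.dist_eq]
  refine (abs_sub_le _ (preisachState ψ (u b) fun r => playFormula r q a) _).trans_lt ?_
  linarith

theorem exists_isSolution (h : DensityHyp ψ μ K) {T : ℝ} (hT : 0 ≤ T)
    {u : ℝ → EuclideanSpace ℝ (Fin L)} {w : ℝ → ℝ} (hu : ContinuousOn u (Icc 0 T))
    (hw : ContinuousOn w (Icc 0 T)) : ∃ q, IsSolution ψ T u w q := by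
  set M := ∫ r in Ioi (0 : ℝ), μ r
  have hM0 : 0 ≤ M := tail_nonneg h.ae_mu_nonneg le_rfl
  have hcont : ∀ q : C(Icc 0 T, ℝ), Continuous (IccExtend hT q) := fun q => q.continuous.Icc_extend'
  have hreg : ∀ q : C(Icc 0 T, ℝ), IsRightContRegulated T (IccExtend hT q) := fun q =>
    isRightContRegulated_of_continuous (hcont q)
  have happ : ∀ (q : C(Icc 0 T, ℝ)) (t : Icc 0 T), IccExtend hT q t = q t := fun q t =>
    IccExtend_val hT q t
  let P : C(Icc 0 T, ℝ) → C(Icc 0 T, ℝ) := fun q =>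
    ⟨fun t => preisachState ψ (u t) fun r => playFormula r (IccExtend hT q) t,
      (h.continuousOn_preisachState hT hu (hcont q)).domRestrict⟩
  have hP : ∀ x y, ‖P x - P y‖ ≤ M * ‖x - y‖ := by
    intro x y
    rw [ContinuousMap.norm_le _ (by positivity)]
    intro t
    have hbx : ∀ τ ∈ Icc (0 : ℝ) t, |IccExtend hT x τ| ≤ max ‖x‖ ‖y‖ := fun τ _ =>
      (x.norm_coe_le_norm _).trans (le_max_left _ _)
    have hby : ∀ τ ∈ Icc (0 : ℝ) t, |IccExtend hT y τ| ≤ max ‖x‖ ‖y‖ := fun τ _ =>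
      (y.norm_coe_le_norm _).trans (le_max_right _ _)
    refine h.abs_preisachState_sub_le (u t) (continuous_playFormula_threshold t.2.1 hbx)
      (continuous_playFormula_threshold t.2.1 hby)
      (fun r hr => abs_playFormula_le t.2.1 (le_of_lt hr) hbx)
      (fun r hr => abs_playFormula_le t.2.1 (le_of_lt hr) hby) fun r hr => ?_
    exact abs_playFormula_sub_le t.2.1 hbx hby fun τ _ => (x - y).norm_coe_le_norm _
  obtain ⟨q, hq⟩ := exists_add_eq_of_lipschitz (P := P) (Real.exp_pos M).le hP
    (fun lam hlam x y => by
      rw [ContinuousMap.norm_le _ (by positivity)]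
      intro t
      have := h.abs_sub_le_of_residual (u := u) hlam (hreg x) (hreg y)
        (ε := ‖(x + lam • P x) - (y + lam • P y)‖) (fun s hs => ?_) t.2
      · rwa [happ, happ] at this
      · have e := ((x + lam • P x) - (y + lam • P y)).norm_coe_le_norm ⟨s, hs⟩
        have ex := happ x ⟨s, hs⟩
        have ey := happ y ⟨s, hs⟩
        dsimp only at ex ey
        rw [ex, ey]
        exact e)
    ⟨fun t => w t, hw.domRestrict⟩
  refine ⟨IccExtend hT q, hreg q, fun t ht => ?_⟩
  rw [preisach_eq (hreg q) ht]
  have e := DFunLike.congr_fun hq ⟨t, ht⟩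
  have et := happ q ⟨t, ht⟩
  dsimp only at et
  rw [et]
  exact e

end DensityHyp

end Preisach

end

/-! ### The proposition -/

theorem proposition5p1 {L : ℕ} (ψ : EuclideanSpace ℝ (Fin L) → ℝ → ℝ → ℝ)
    (μ : ℝ → ℝ) (K : ℝ → ℝ → ℝ) (hψ : Preisach.DensityHyp ψ μ K)
    (M M₁ : ℝ) (hM : M = ∫ r in Ioi (0 : ℝ), μ r)
    (hM₁ : M₁ = ∫ r in Ioi (0 : ℝ), ∫ v : ℝ, K r v)
    (T : ℝ) (hT : 0 < T)
    (u : ℝ → EuclideanSpace ℝ (Fin L)) (w : ℝ → ℝ)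
    (hu : ContinuousOn u (Icc 0 T)) (hw : ContinuousOn w (Icc 0 T)) :
    (∃ q : ℝ → ℝ, Preisach.IsSolution ψ T u w q) ∧
    ∀ q : ℝ → ℝ, Preisach.IsSolution ψ T u w q →
      (∀ q' : ℝ → ℝ, Preisach.IsSolution ψ T u w q' → EqOn q' q (Icc 0 T)) ∧
      ContinuousOn q (Icc 0 T) ∧
      (AbsolutelyContinuousOnInterval u 0 T → AbsolutelyContinuousOnInterval w 0 T →
        AbsolutelyContinuousOnInterval q 0 T ∧
        ∀ᵐ t ∂volume.restrict (Icc 0 T),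
          DifferentiableAt ℝ q t ∧ DifferentiableAt ℝ w t ∧ DifferentiableAt ℝ u t ∧
          |deriv q t| ≤ Real.exp M * (|deriv w t| + M₁ * ‖deriv u t‖)) := by
  subst hM hM₁
  refine ⟨hψ.exists_isSolution hT.le hu hw, fun q hq => ⟨fun q' hq' t ht => ?_,
    hψ.continuousOn_of_isSolution hu hw hq, fun huac hwac => ?_⟩⟩
  · have := hψ.abs_sub_le_of_residual (lam := 1) (u := u) (ε := 0) ⟨zero_le_one, le_rfl⟩
      hq'.1 hq.1 (fun s hs => by
        rw [one_mul, one_mul, ← Preisach.preisach_eq hq'.1 hs, ← Preisach.preisach_eq hq.1 hs,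
          hq'.2 s hs, hq.2 s hs, sub_self, abs_zero]) ht
    rw [mul_zero] at this
    exact sub_eq_zero.1 (abs_nonpos_iff.1 this)
  · have hqac := hψ.absolutelyContinuous_of_isSolution hT.le huac hwac hq
    refine ⟨hqac, ?_⟩
    rw [ae_restrict_iff' measurableSet_Icc]
    -- The derivative bound comes from right increments and so is available only before T.
    have hne : ∀ᵐ x : ℝ, x ≠ T := by simp [ae_iff, measure_singleton]
    filter_upwards [hqac.ae_differentiableAt, hwac.ae_differentiableAt,
      huac.boundedVariationOn.ae_differentiableAt_of_mem_uIcc, hne] with t h1 h2 h3 h4 ht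
    rw [uIcc_of_le hT.le] at h1 h2 h3
    exact ⟨h1 ht, h2 ht, h3 ht, hψ.abs_deriv_le_of_isSolution hq
      ⟨ht.1, lt_of_le_of_ne ht.2 h4⟩ (h1 ht) (h2 ht) (h3 ht)⟩
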